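/- **Setting.** Let $\Lambda=\{l-(\tfrac12,\tfrac12): l\in\mathbb Z^2\}$, $\Gamma_\pm=\{m\in\Lambda: m_1<0,\ m_2=\pm\tfrac12\}$, $\mathcal R=\{e_1,e_2,-e_1,-e_2\}$, and let $\mathcal R(m)=\mathcal R\setminus\{\mp e_2\}$ for $m\in\Gamma_\pm$ and $\mathcal R(m)=\mathcal R$ for all other $m\in\Lambda$. For $u:\Lambda\to\mathbb R$ let $Du(m)\in\mathbb R^{\mathcal R}$ have the components $(Du(m))_\rho=u(m+\rho)-u(m)$ if $\rho\in\mathcal R(m)$ and $(Du(m))_\rho=0$ otherwise. Let $$\dot{\mathcal H}^1=\{u:\Lambda\to\mathbb R \;:\; Du\in\ell^2,\ u(\tfrac12,\tfrac12)=0\},\qquad \|u\|_{\dot{\mathcal H}^1}=\|Du\|_{\ell^2}=\Big(\sum_{m\in\Lambda}|Du(m)|^2\Big)^{1/2}.$$ Let $k\ge5$ be an integer, and let $\phi\in C^k(\mathbb R)$ satisfy $\phi(0)=0$, $\phi(-r)=\phi(r)$ for all $r$, and $\phi''(0)=1$. Put $V(g)=\sum_{\rho\in\mathcal R}\phi(g_\rho)$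 for $g\in\mathbb R^{\mathcal R}$. For $\epsilon\in\mathbb R$ let $\hat u(x)=\hat u_\epsilon(x)=\epsilon\sqrt r\,\sin(\theta/2)$ for $x=(r\cos\theta,r\sin\theta)$, $r>0$, $\theta\in(-\pi,\pi)$. The energy-difference functional is $$\mathcal E_\epsilon(u)=\sum_{m\in\Lambda}\big[V(D\hat u(m)+Du(m))-V(D\hat u(m))\big],$$ which is a finite sum if $Du$ has finite support; on all of $\dot{\mathcal H}^1$ it is understood as the extension by continuity from the $u\in\dot{\mathcal H}^1$ of finite support, that is, $\mathcal E_\epsilon(u)=\lim\mathcal E_\epsilon(w)$ as $w\to u$ in $\dot{\mathcal H}^1$ with $w\in\dot{\mathcal H}^1$ of finite support. **Theorem 2.1.** 1. The finitely supported $u\in\dot{\mathcal H}^1$ are dense in $\dot{\mathcal H}^1$. For every $\epsilon\in\mathbb R$, $\mathcal E_\epsilon$ is well defined on $\dot{\mathcal H}^1$: the above limit exists for every $u\in\dot{\mathcal H}^1$, and it equals the finite sum whenever $Du$ has finite support. Moreover, $\mathcal E_\epsilon$ is $k$ times continuously (Fréchet) differentiable on $\dot{\mathcal H}^1$. 2.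 There are $\epsilon_0,r,\lambda>0$ and a continuous map $\epsilon\mapsto\bar u(\epsilon)$ from $(-\epsilon_0,\epsilon_0)$ to $\dot{\mathcal H}^1$ such that for every $|\epsilon|<\epsilon_0$: $\|\bar u(\epsilon)\|_{\dot{\mathcal H}^1}<r$; $\bar u(\epsilon)$ is the only critical point of $\mathcal E_\epsilon$ in the ball $\{\|u\|_{\dot{\mathcal H}^1}<r\}$; $\mathcal E_\epsilon(\bar u(\epsilon))<\mathcal E_\epsilon(u)$ for every other $u$ in this ball, so that $\bar u(\epsilon)$ is a strict local minimiser; and $\bar u(\epsilon)$ is strongly stable, $$\delta^2\mathcal E_\epsilon(\bar u(\epsilon))[v,v]\ \ge\ \lambda\,\|v\|_{\dot{\mathcal H}^1}^2\qquad\text{for all }v\in\dot{\mathcal H}^1 .$$ -/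

import Mathlib

open Filter Topology Set

noncomputable section

namespace AntiPlaneCrack

/-! ### The cracked lattice -/

/-- Index set of the lattice `Λ = {l - (1/2, 1/2) | l ∈ ℤ²}`: the index `l` stands for the lattice
point `pos l`, and adding an integer vector to `l` translates the lattice point by it. -/
abbrev Site : Type := ℤ × ℤ

/-- The lattice point `l - (1/2, 1/2) ∈ ℝ²`. -/
def pos (l : Site) : ℝ × ℝ := ((l.1 : ℝ) - 1 / 2, (l.2 : ℝ) - 1 / 2)

/-- The lattice points `Γ₊` directly above the crack. -/
def upperFace : Set Site := {l | (pos l).1 < 0 ∧ (pos l).2 = 1 / 2}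

/-- The lattice points `Γ₋` directly below the crack. -/
def lowerFace : Set Site := {l | (pos l).1 < 0 ∧ (pos l).2 = -(1 / 2)}

/-- The lattice point `(1/2, 1/2)`, at which displacements are normalised. -/
def refSite : Site := (1, 1)

theorem pos_refSite : pos refSite = (1 / 2, 1 / 2) := by
  simp only [pos, refSite]; norm_num

/-- The nearest-neighbour directions `{e₁, e₂, -e₁, -e₂}`. -/
def dirs : Finset (ℤ × ℤ) := {(1, 0), (0, 1), (-1, 0), (0, -1)}

open Classical in
/-- The directions of the bonds present at `m`: the bonds crossing the crack are removed. -/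
def dirsAt (m : Site) : Finset (ℤ × ℤ) :=
  if m ∈ upperFace then dirs \ {(0, -1)}
  else if m ∈ lowerFace then dirs \ {(0, 1)}
  else dirs

/-- `ℝ^R` with its Euclidean norm, `R` being the set of four nearest-neighbour directions. -/
abbrev Stencil : Type := EuclideanSpace ℝ dirs

open Classical in
/-- The discrete gradient `Du(m) ∈ ℝ^R`, with zero components along the removed bonds. -/
def grad (u : Site → ℝ) (m : Site) : Stencil :=
  WithLp.toLp 2 fun ρ : dirs => if (ρ : ℤ × ℤ) ∈ dirsAt m then u (m + ρ) - u m else 0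

theorem grad_add (u v : Site → ℝ) : grad (u + v) = grad u + grad v := by
  funext m; ext ρ
  simp only [grad, Pi.add_apply, PiLp.add_apply]
  split_ifs <;> ring

theorem grad_smul (c : ℝ) (u : Site → ℝ) : grad (c • u) = c • grad u := by
  funext m; ext ρ
  simp only [grad, Pi.smul_apply, PiLp.smul_apply, smul_eq_mul]
  split_ifs <;> ring

theorem grad_zero : grad 0 = 0 := by
  funext m; ext ρ
  simp [grad]

/-! ### The discrete energy space -/

/-- The displacements `u : Λ → ℝ` with `Du ∈ ℓ²` and `u (1/2, 1/2) = 0`, as a linear space. -/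
def energySubmodule : Submodule ℝ (Site → ℝ) where
  carrier := {u | Memℓp (grad u) 2 ∧ u refSite = 0}
  zero_mem' := ⟨by rw [grad_zero]; exact zero_memℓp, rfl⟩
  add_mem' := by
    rintro u v ⟨hu, hu0⟩ ⟨hv, hv0⟩
    refine ⟨?_, by simp [hu0, hv0]⟩
    rw [grad_add]; exact hu.add hv
  smul_mem' := by
    rintro c u ⟨hu, hu0⟩
    refine ⟨?_, by simp [hu0]⟩
    rw [grad_smul]; exact hu.const_smul c

/-- The discrete energy space `Ḣ¹`. (A type of its own, so that it carries the energy norm below and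
not the topology of pointwise convergence.) -/
def H1 : Type := energySubmodule

instance : AddCommGroup H1 := inferInstanceAs (AddCommGroup energySubmodule)
instance : Module ℝ H1 := inferInstanceAs (Module ℝ energySubmodule)

/-- The displacement `Λ → ℝ` underlying an element of `Ḣ¹`. -/
def H1.disp (u : H1) : Site → ℝ := Subtype.val u

/-- The discrete gradient as a linear map `Ḣ¹ → ℓ²(Λ; ℝ^R)`. -/
def gradLp : H1 →ₗ[ℝ] lp (fun _ : Site => Stencil) 2 where
  toFun u := ⟨grad u.disp, u.property.1⟩
  map_add' u v := Subtype.ext (grad_add u.disp v.disp)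
  map_smul' c u := Subtype.ext (grad_smul c u.disp)

theorem horizontal_mem_dirsAt (m : Site) : ((1, 0) : ℤ × ℤ) ∈ dirsAt m := by
  unfold dirsAt
  split_ifs <;> simp [dirs]

theorem vertical_mem_dirsAt (b : ℤ) : ((0, 1) : ℤ × ℤ) ∈ dirsAt (1, b) := by
  have h : ¬ ((pos (1, b)).1 < 0) := by simp only [pos]; norm_num
  have h1 : ((1, b) : Site) ∉ upperFace := fun hm => h hm.1
  have h2 : ((1, b) : Site) ∉ lowerFace := fun hm => h hm.1
  simp [dirsAt, h1, h2, dirs]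

theorem step_eq_of_grad_eq_zero {u : Site → ℝ} (hu : grad u = 0) (m : Site) {ρ : ℤ × ℤ}
    (hρ : ρ ∈ dirs) (hm : ρ ∈ dirsAt m) : u (m + ρ) = u m := by
  have h := congrArg (fun g : Stencil => g ⟨ρ, hρ⟩) (congrFun hu m)
  simp only [grad, hm, if_true, Pi.zero_apply, PiLp.zero_apply] at h
  linarith

theorem const_of_step {f : ℤ → ℝ} (hf : ∀ a, f (a + 1) = f a) (a : ℤ) : f a = f 1 := by
  induction a using Int.induction_on with
  | zero => have := hf 0; simpa using this.symm
  | succ i ih => rw [hf, ih]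
  | pred i ih => rw [← ih, ← hf (-(i : ℤ) - 1)]; congr 1; ring

theorem gradLp_injective : Function.Injective gradLp := by
  rw [← LinearMap.ker_eq_bot, LinearMap.ker_eq_bot']
  intro u hu
  have hg : grad u.disp = 0 := congrArg Subtype.val hu
  have h0 : u.disp (1, 1) = 0 := u.property.2
  apply Subtype.ext
  funext ⟨a, b⟩
  change u.disp (a, b) = 0
  have hh : u.disp (a, b) = u.disp (1, b) :=
    const_of_step (f := fun a => u.disp (a, b)) (fun a => by
      simpa using step_eq_of_grad_eq_zero hg (a, b) (by simp [dirs]) (horizontal_mem_dirsAt (a, b))) a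
  have hv : u.disp (1, b) = u.disp (1, 1) :=
    const_of_step (f := fun b => u.disp (1, b)) (fun b => by
      simpa using step_eq_of_grad_eq_zero hg (1, b) (by simp [dirs]) (vertical_mem_dirsAt b)) b
  rw [hh, hv, h0]

/-- The norm `‖u‖ = ‖Du‖_{ℓ²}` of `Ḣ¹`. -/
instance : NormedAddCommGroup H1 :=
  NormedAddCommGroup.induced H1 (lp (fun _ : Site => Stencil) 2) gradLp gradLp_injective

instance : NormedSpace ℝ H1 :=
  NormedSpace.induced ℝ H1 (lp (fun _ : Site => Stencil) 2) gradLp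

theorem norm_sq_eq (u : H1) : ‖u‖ ^ 2 = ∑' m : Site, ‖grad u.disp m‖ ^ 2 := by
  have h := lp.norm_rpow_eq_tsum (p := 2) (by norm_num) (gradLp u)
  have h2 : (2 : ENNReal).toReal = 2 := by norm_num
  rw [h2] at h
  simp only [Real.rpow_two] at h
  exact h

/-! ### The energy -/

/-- The nearest-neighbour pair potential `V : ℝ^R → ℝ`, `V(g) = ∑_ρ φ(g_ρ)`. -/
def pairPotential (φ : ℝ → ℝ) (g : Stencil) : ℝ := ∑ ρ : dirs, φ (g ρ)

/-- The complex square root map `ω`, in polar coordinates with angle in `(-π, π]`: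
`(r cos θ, r sin θ) ↦ (√r cos (θ/2), √r sin (θ/2))`. -/
def sqrtMap (x : ℝ × ℝ) : ℝ × ℝ :=
  (√‖(⟨x.1, x.2⟩ : ℂ)‖ * Real.cos (Complex.arg ⟨x.1, x.2⟩ / 2),
   √‖(⟨x.1, x.2⟩ : ℂ)‖ * Real.sin (Complex.arg ⟨x.1, x.2⟩ / 2))

/-- The far-field predictor `û = ε ω₂`, on lattice points. -/
def predictor (ε : ℝ) (m : Site) : ℝ := ε * (sqrtMap (pos m)).2

/-- The series `∑_m [V(Dû(m) + Du(m)) - V(Dû(m))]`. It is used as it stands only for `u` with finitely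
many nonzero summands; for a general `u ∈ Ḣ¹` it need not converge. -/
def energySeries (φ : ℝ → ℝ) (ε : ℝ) (u : H1) : ℝ :=
  ∑' m : Site,
    (pairPotential φ (grad (predictor ε) m + grad u.disp m) - pairPotential φ (grad (predictor ε) m))

/-- The compactly (that is, finitely) supported displacements in `Ḣ¹`. -/
def compactlySupported : Set H1 := {u | (Function.support u.disp).Finite}

/-- The energy-difference functional `𝓔` on `Ḣ¹`: the extension by continuity of the series from the
compactly supported displacements, `𝓔(u) = lim 𝓔(w)` as `w → u` with `w` compactly supported.
That this limit exists for every `u`, and that it agrees with the series where the latter is a finite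
sum, is not part of the definition. -/
def energy (φ : ℝ → ℝ) (ε : ℝ) : H1 → ℝ :=
  extendFrom compactlySupported (energySeries φ ε)

end AntiPlaneCrack

end

open AntiPlaneCrack

/-!
Write `α` for the strains of the unit predictor `ω₂ = Im √z`, one for every oriented bond of the cracked
lattice, and `x = Du`. Formally, with `f` the Laplacian of `ω₂` on the cracked lattice,
`𝓔(u) = ∑_b [φ(ε α_b + x_b) - φ(ε α_b) - ε α_b x_b] + ε ∑_b α_b x_b`, `∑_b α_b x_b = -2 ∑_m f(m) u(m)`.

The first series converges absolutely for all `x ∈ ℓ²`: since `φ` is even with `φ''(0) = 1`,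
`φ'(t) - t = O(t³)`, and `α_b = O(|z|^(-1/2))` makes `φ'(ε α) - ε α` square summable on the
two-dimensional lattice. The force `x ↦ φ'(ε α + x) - ε α` maps `ℓ²` to itself and has the
derivative "multiply by `φ''(ε α + x) ∈ ℓ^∞`". The superposition operators `f ↦ g ∘ f` on `ℓ^∞` are as
smooth as `g` (`contDiff_superposition`), so this part of the energy is `C^k`
(`contDiff_renormEnergy`).

The second series need not converge on the energy space, but its form after summation by parts does.
The predictor satisfies the Neumann condition on the crack, hence `√z` continues across the crack to an
even function, and deleting a bond across the crack does not change the Laplacian. Expanding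
`√(1 + ρ/z)` in the four directions, all terms below fourth order cancel, so that
`f = O(|z|^(-7/2))` (`abs_residual_le`). As `u` grows at most linearly, `∑ f u` is a bounded functional
(`residualForce`). For a displacement which is constant, but not zero, near infinity, the
identity still holds, as `∑ f = 0` by the odd symmetry of `ω₂`.

Finitely supported displacements are dense (`dense_compactlySupported`) since the plane is parabolic: there is
a function tending to infinity with square summable differences, which provides the cut-offs.

For small `ε` and `u` all arguments of `φ''` are near `0`, where `φ''` is within `1/2` of `1`. The derivative
of the energy then differs from the Riesz map by a map of Lipschitz constant `1/2`, and
`exists_branch_of_nearRiesz` gives the critical point by the contraction principle, and its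
uniqueness, minimality, stability and continuous dependence by strong monotonicity.
-/


noncomputable section

namespace AntiPlaneCrack

/-! ### Taylor estimates for functions of one variable -/

/-- The mean value inequality in the form used for superposition operators: the linearisation error
of a `C¹` function is small relative to the increment, uniformly on bounded sets. -/
theorem exists_abs_linearization_le {g : ℝ → ℝ} (hg : ContDiff ℝ 1 g) (R : ℝ) {ε : ℝ} (hε : 0 < ε) :
    ∃ δ > 0, ∀ s t : ℝ, |s| ≤ R → |t| < δ → |g (s + t) - g s - deriv g s * t| ≤ ε * |t| := by
  have huc := (isCompact_Icc (a := -(R + 1)) (b := R + 1)).uniformContinuousOn_of_continuous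
    (hg.continuous_deriv le_rfl).continuousOn
  obtain ⟨δ, hδ, h⟩ := Metric.uniformContinuousOn_iff.1 huc ε hε
  refine ⟨min δ 1, by positivity, fun s t hs ht => ?_⟩
  have hd : ∀ x, HasDerivAt g (deriv g x) x := fun x =>
    (hg.differentiable one_ne_zero x).hasDerivAt
  have key := (convex_uIcc s (s + t)).norm_image_sub_le_of_norm_hasDerivWithin_le
    (f := fun x => g x - deriv g s * x) (f' := fun x => deriv g x - deriv g s) (C := ε)
    (x := s) (y := s + t)
    (fun x _ => ((hd x).sub (by simpa using (hasDerivAt_id x).const_mul (deriv g s))).hasDerivWithinAt)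
    (fun x hx => by
      have hx' : |x - s| ≤ |t| := by
        simpa using abs_sub_left_of_mem_uIcc hx
      rw [lt_min_iff] at ht
      rw [abs_le] at hs
      have h1 := abs_le.1 hx'
      have h2 := abs_lt.1 ht.2
      have := h x ⟨by linarith, by linarith⟩ s ⟨by linarith, by linarith⟩
        (by rw [Real.dist_eq]; exact lt_of_le_of_lt hx' ht.1)
      rw [Real.dist_eq] at this
      exact this.le)
    left_mem_uIcc right_mem_uIcc
  have e : g (s + t) - deriv g s * (s + t) - (g s - deriv g s * s)
      = g (s + t) - g s - deriv g s * t := by ring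
  simpa [Real.norm_eq_abs, e] using key

/-- Boundedness of the derivative turns into a Lipschitz bound, uniformly on bounded sets. -/
theorem exists_abs_sub_le {g : ℝ → ℝ} (hg : ContDiff ℝ 1 g) (R : ℝ) :
    ∃ C ≥ 0, ∀ s t : ℝ, |s| ≤ R → |t| ≤ R → |g t - g s| ≤ C * |t - s| := by
  obtain ⟨C, hC⟩ := (isCompact_Icc (a := -R) (b := R)).exists_bound_of_continuousOn
    (hg.continuous_deriv le_rfl).continuousOn
  refine ⟨max C 0, le_max_right _ _, fun s t hs ht => ?_⟩
  have := (convex_Icc (-R) R).norm_image_sub_le_of_norm_hasDerivWithin_le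
    (f := g) (f' := deriv g) (C := max C 0)
    (fun x _ => (hg.differentiable one_ne_zero x).hasDerivAt.hasDerivWithinAt)
    (fun x hx => (hC x hx).trans (le_max_left _ _)) (abs_le.1 hs) (abs_le.1 ht)
  simpa [Real.norm_eq_abs] using this

/-- Second-order Taylor estimate, uniformly on bounded sets. -/
theorem exists_abs_linearization_le_sq {g : ℝ → ℝ} (hg : ContDiff ℝ 2 g) (R : ℝ) :
    ∃ C ≥ 0, ∀ s t : ℝ, |s| ≤ R → |s + t| ≤ R →
      |g (s + t) - g s - deriv g s * t| ≤ C * t ^ 2 := by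
  have hg' : ContDiff ℝ 1 (deriv g) := by
    have : ContDiff ℝ (1 + 1) g := by simpa [one_add_one_eq_two] using hg
    exact (contDiff_succ_iff_deriv.1 this).2.2
  obtain ⟨C, hC0, hC⟩ := exists_abs_sub_le hg' R
  refine ⟨C, hC0, fun s t hs ht => ?_⟩
  have hd : ∀ x, HasDerivAt g (deriv g x) x := fun x =>
    (hg.differentiable two_ne_zero x).hasDerivAt
  have key := (convex_uIcc s (s + t)).norm_image_sub_le_of_norm_hasDerivWithin_le
    (f := fun x => g x - deriv g s * x) (f' := fun x => deriv g x - deriv g s) (C := C * |t|)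
    (x := s) (y := s + t)
    (fun x _ => ((hd x).sub (by simpa using (hasDerivAt_id x).const_mul (deriv g s))).hasDerivWithinAt)
    (fun x hx => by
      have hx' : |x - s| ≤ |t| := by
        simpa using abs_sub_left_of_mem_uIcc hx
      have hxR : |x| ≤ R := by
        have h1 := abs_le.1 hs
        have h2 := abs_le.1 ht
        have := uIcc_subset_Icc (a₂ := -R) (b₂ := R) ⟨h1.1, h1.2⟩ ⟨h2.1, h2.2⟩ hx
        exact abs_le.2 this
      exact (hC s x hs hxR).trans (mul_le_mul_of_nonneg_left hx' hC0))
    left_mem_uIcc right_mem_uIcc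
  have e : g (s + t) - deriv g s * (s + t) - (g s - deriv g s * s)
      = g (s + t) - g s - deriv g s * t := by ring
  have e2 : C * |t| * |t| = C * t ^ 2 := by rw [mul_assoc, abs_mul_abs_self, sq]
  simpa [Real.norm_eq_abs, e, e2] using key

/-- If `f 0 = 0` and `f' = O(|t|^n)` on `[-R, R]`, then `f = O(|t|^(n+1))` there. -/
theorem abs_le_pow_succ_of_abs_deriv_le {f : ℝ → ℝ} (hf : Differentiable ℝ f) (h0 : f 0 = 0)
    {C R : ℝ} (hC : 0 ≤ C) {n : ℕ} (h : ∀ t, |t| ≤ R → |deriv f t| ≤ C * |t| ^ n) (t : ℝ)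
    (ht : |t| ≤ R) : |f t| ≤ C * |t| ^ (n + 1) := by
  have key := (convex_uIcc 0 t).norm_image_sub_le_of_norm_hasDerivWithin_le
    (f := f) (f' := deriv f) (C := C * |t| ^ n)
    (fun x _ => (hf x).hasDerivAt.hasDerivWithinAt)
    (fun x hx => by
      have hx' : |x| ≤ |t| := by simpa using abs_sub_left_of_mem_uIcc hx
      exact (h x (hx'.trans ht)).trans (by gcongr))
    left_mem_uIcc right_mem_uIcc
  simpa [Real.norm_eq_abs, h0, pow_succ, mul_assoc] using key

/-- An even potential with `φ''(0) = 1` is quadratic at `0` up to fourth order. This cubic bound on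
the nonlinear part of the force makes the latter square summable for strains that decay like
`|z|^(-1/2)`; a quadratic bound would not. -/
theorem exists_abs_deriv_sub_id_le {φ : ℝ → ℝ} (hφ : ContDiff ℝ 4 φ)
    (heven : ∀ r, φ (-r) = φ r) (h2 : deriv (deriv φ) 0 = 1) (R : ℝ) :
    ∃ C ≥ 0, ∀ t, |t| ≤ R → |deriv φ t - t| ≤ C * |t| ^ 3 := by
  have c1 : ContDiff ℝ 3 (deriv φ) := by
    have : ContDiff ℝ (3 + 1) φ := by norm_num; exact hφ
    exact (contDiff_succ_iff_deriv.1 this).2.2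
  have c2 : ContDiff ℝ 2 (deriv (deriv φ)) := by
    have : ContDiff ℝ (2 + 1) (deriv φ) := by norm_num; exact c1
    exact (contDiff_succ_iff_deriv.1 this).2.2
  have c3 : ContDiff ℝ 1 (deriv (deriv (deriv φ))) := by
    have : ContDiff ℝ (1 + 1) (deriv (deriv φ)) := by norm_num; exact c2
    exact (contDiff_succ_iff_deriv.1 this).2.2
  have o1 : ∀ r, deriv φ (-r) = -deriv φ r := fun r => by
    have : (fun x => φ (-x)) = φ := funext heven
    have h := deriv_comp_neg φ r
    rw [this] at h
    linarith
  have e2 : ∀ r, deriv (deriv φ) (-r) = deriv (deriv φ) r := fun r => by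
    have : (fun x => deriv φ (-x)) = fun x => -deriv φ x := funext o1
    have h := deriv_comp_neg (deriv φ) r
    rw [this, deriv.fun_neg] at h
    linarith
  have o3 : ∀ r, deriv (deriv (deriv φ)) (-r) = -deriv (deriv (deriv φ)) r := fun r => by
    have : (fun x => deriv (deriv φ) (-x)) = deriv (deriv φ) := funext e2
    have h := deriv_comp_neg (deriv (deriv φ)) r
    rw [this] at h
    linarith
  have z1 : deriv φ 0 = 0 := by have := o1 0; rw [neg_zero] at this; linarith
  have z3 : deriv (deriv (deriv φ)) 0 = 0 := by have := o3 0; rw [neg_zero] at this; linarith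
  obtain ⟨C, hC0, hC⟩ := exists_abs_sub_le c3 R
  have d2 : Differentiable ℝ (fun t => deriv (deriv φ) t - 1) :=
    (c2.differentiable two_ne_zero).sub_const 1
  have d1 : Differentiable ℝ (fun t => deriv φ t - t) :=
    (c1.differentiable three_ne_zero).sub differentiable_id
  refine ⟨C, hC0, fun t ht => ?_⟩
  refine abs_le_pow_succ_of_abs_deriv_le d1 (by simp [z1]) hC0 (fun t ht => ?_) t ht
  have : deriv (fun t => deriv φ t - t) t = deriv (deriv φ) t - 1 := by
    exact ((c1.differentiable three_ne_zero t).hasDerivAt.sub (hasDerivAt_id t)).deriv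
  rw [this]
  refine abs_le_pow_succ_of_abs_deriv_le d2 (by simp [h2]) hC0 (fun t ht => ?_) t ht
  have : deriv (fun t => deriv (deriv φ) t - 1) t = deriv (deriv (deriv φ)) t := by
    rw [deriv_sub_const]
  rw [this]
  have h0R : |(0:ℝ)| ≤ R := by simpa using (abs_nonneg t).trans ht
  simpa [z3] using hC 0 t h0R ht

/-! ### Sequence spaces -/

variable {ι : Type*}

/-- Real square summable families, with the `ℓ²` norm. -/
abbrev L2 (ι : Type*) : Type _ := lp (fun _ : ι => ℝ) 2

/-- Real bounded families, with the supremum norm. -/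
abbrev LInf (ι : Type*) : Type _ := lp (fun _ : ι => ℝ) ⊤

theorem memℓp_two_iff {f : ι → ℝ} : Memℓp f 2 ↔ Summable fun i => f i ^ 2 := by
  rw [memℓp_gen_iff (by norm_num)]
  simp

theorem L2.norm_sq_eq_tsum (x : L2 ι) : ‖x‖ ^ 2 = ∑' i, x i ^ 2 := by
  have h := lp.norm_rpow_eq_tsum (p := 2) (by norm_num) x
  simpa using h

theorem L2.summable_sq (x : L2 ι) : Summable fun i => x i ^ 2 := memℓp_two_iff.1 x.2

theorem L2.summable_mul (x y : L2 ι) : Summable fun i => x i * y i := by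
  have := (lp.hasSum_inner (𝕜 := ℝ) x y).summable
  simpa [mul_comm] using this

theorem L2.inner_eq_tsum_mul (x y : L2 ι) : inner ℝ x y = ∑' i, x i * y i := by
  rw [lp.inner_eq_tsum]
  simp [mul_comm]

theorem L2.abs_apply_le (x : L2 ι) (i : ι) : |x i| ≤ ‖x‖ :=
  lp.norm_apply_le_norm two_ne_zero x i

theorem LInf.abs_apply_le (x : LInf ι) (i : ι) : |x i| ≤ ‖x‖ :=
  lp.norm_apply_le_norm ENNReal.top_ne_zero x i

theorem L2.norm_le_of_abs_le {x y : L2 ι} {C : ℝ} (hC : 0 ≤ C) (h : ∀ i, |x i| ≤ C * |y i|) :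
    ‖x‖ ≤ C * ‖y‖ := by
  refine abs_le_of_sq_le_sq' ?_ (by positivity) |>.2
  rw [mul_pow, L2.norm_sq_eq_tsum, L2.norm_sq_eq_tsum, ← tsum_mul_left]
  refine Summable.tsum_le_tsum (fun i => ?_) x.summable_sq (y.summable_sq.mul_left _)
  rw [← mul_pow, ← sq_abs (x i), ← sq_abs (C * y i), abs_mul, abs_of_nonneg hC]
  exact pow_le_pow_left₀ (abs_nonneg _) (h i) 2

theorem memℓp_two_of_abs_le {f : ι → ℝ} {G : ι → ℝ} (hG : Summable fun i => G i ^ 2)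
    (h : ∀ i, |f i| ≤ G i) : Memℓp f 2 := by
  refine memℓp_two_iff.2 (hG.of_nonneg_of_le (fun i => sq_nonneg _) fun i => ?_)
  rw [← sq_abs (f i)]
  exact pow_le_pow_left₀ (abs_nonneg _) (h i) 2

/-- Dominated convergence in `ℓ²`. -/
theorem L2.tendsto_of_dominated {β : Type*} {l : Filter β} {f : β → L2 ι} {g : L2 ι} {G : ι → ℝ}
    (hG : Summable fun i => G i ^ 2) (hlim : ∀ i, Tendsto (fun n => f n i) l (𝓝 (g i)))
    (hdom : ∀ᶠ n in l, ∀ i, |f n i| ≤ G i) : Tendsto f l (𝓝 g) := by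
  rcases l.eq_or_neBot with rfl | hl
  · simp
  rw [tendsto_iff_norm_sub_tendsto_zero]
  have hg : ∀ i, |g i| ≤ G i := fun i =>
    le_of_tendsto (hlim i).abs (hdom.mono fun n hn => hn i)
  have key : Tendsto (fun n => ∑' i, (f n i - g i) ^ 2) l (𝓝 (∑' _ : ι, (0 : ℝ))) := by
    refine tendsto_tsum_of_dominated_convergence (hG.mul_left 4) (fun i => ?_) ?_
    · simpa using ((hlim i).sub_const (g i)).pow 2
    · filter_upwards [hdom] with n hn i
      rw [Real.norm_eq_abs, abs_pow]
      have : |f n i - g i| ≤ 2 * G i := (abs_sub _ _).trans (by linarith [hn i, hg i])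
      calc |f n i - g i| ^ 2 ≤ (2 * G i) ^ 2 := pow_le_pow_left₀ (abs_nonneg _) this 2
        _ = 4 * G i ^ 2 := by ring
  rw [tsum_zero] at key
  have h2 := key.sqrt
  rw [Real.sqrt_zero] at h2
  refine h2.congr fun n => ?_
  have : ∑' i, (f n i - g i) ^ 2 = ‖f n - g‖ ^ 2 := by
    rw [L2.norm_sq_eq_tsum]; rfl
  rw [this, Real.sqrt_sq (norm_nonneg _)]

theorem memℓp_top_of_two (x : L2 ι) : Memℓp (fun i => x i) ⊤ :=
  memℓp_infty ⟨‖x‖, by rintro _ ⟨i, rfl⟩; exact x.abs_apply_le i⟩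

/-- The inclusion of `ℓ²` into `ℓ^∞`. -/
def L2.toLInf : L2 ι →L[ℝ] LInf ι :=
  LinearMap.mkContinuous
    { toFun := fun x => (⟨fun i => x i, memℓp_top_of_two x⟩ : LInf ι)
      map_add' := fun _ _ => Subtype.ext rfl
      map_smul' := fun _ _ => Subtype.ext rfl } 1
    (fun x => by
      rw [one_mul]
      refine lp.norm_le_of_forall_le (norm_nonneg x) fun i => ?_
      exact x.abs_apply_le i)

theorem memℓp_two_mul (c : LInf ι) (x : L2 ι) : Memℓp (fun i => c i * x i) 2 := by
  refine memℓp_two_of_abs_le (G := fun i => ‖c‖ * |x i|) ?_ fun i => ?_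
  · simpa [mul_pow] using x.summable_sq.mul_left (‖c‖ ^ 2)
  · rw [abs_mul]
    exact mul_le_mul_of_nonneg_right (c.abs_apply_le i) (abs_nonneg _)

/-- Multiplication of a square summable family by a bounded one. -/
def L2.mulCLM : LInf ι →L[ℝ] L2 ι →L[ℝ] L2 ι :=
  LinearMap.mkContinuous₂
    (LinearMap.mk₂ ℝ (fun c x => (⟨fun i => c i * x i, memℓp_two_mul c x⟩ : L2 ι))
      (fun c d x => by ext i; exact add_mul (c i) (d i) (x i))
      (fun r c x => by ext i; exact mul_assoc r (c i) (x i))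
      (fun c x y => by ext i; exact mul_add (c i) (x i) (y i))
      (fun r c x => by ext i; exact mul_left_comm (c i) r (x i))) 1
    (fun c x => by
      rw [one_mul]
      refine L2.norm_le_of_abs_le (norm_nonneg c) fun i => ?_
      change |c i * x i| ≤ _
      rw [abs_mul]
      exact mul_le_mul_of_nonneg_right (c.abs_apply_le i) (abs_nonneg _))

/-- Multiplication in `ℓ^∞`. -/
def LInf.mulCLM : LInf ι →L[ℝ] LInf ι →L[ℝ] LInf ι := ContinuousLinearMap.mul ℝ (LInf ι)

/-! ### Superposition operators -/

theorem memℓp_top_comp {g : ℝ → ℝ} (hg : Continuous g) (f : LInf ι) :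
    Memℓp (fun i => g (f i)) ⊤ := by
  obtain ⟨C, hC⟩ := (isCompact_Icc (a := -‖f‖) (b := ‖f‖)).exists_bound_of_continuousOn
    hg.continuousOn
  exact memℓp_infty ⟨C, by rintro _ ⟨i, rfl⟩; exact hC _ (abs_le.1 (f.abs_apply_le i))⟩

/-- The superposition (Nemytskii) operator `f ↦ g ∘ f` on `ℓ^∞`. -/
def superposition {g : ℝ → ℝ} (hg : Continuous g) (f : LInf ι) : LInf ι :=
  ⟨fun i => g (f i), memℓp_top_comp hg f⟩

theorem continuous_superposition {g : ℝ → ℝ} (hg : Continuous g) :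
    Continuous (superposition hg : LInf ι → LInf ι) := by
  rw [Metric.continuous_iff]
  intro f ε hε
  have huc := (isCompact_Icc (a := -(‖f‖ + 1)) (b := ‖f‖ + 1)).uniformContinuousOn_of_continuous
    hg.continuousOn
  obtain ⟨δ, hδ, h⟩ := Metric.uniformContinuousOn_iff.1 huc (ε / 2) (by positivity)
  refine ⟨min δ 1, by positivity, fun f' hf' => ?_⟩
  rw [dist_eq_norm, lt_min_iff] at hf'
  rw [dist_eq_norm]
  refine lt_of_le_of_lt (lp.norm_le_of_forall_le (C := ε / 2) (by positivity) fun i => ?_)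
    (half_lt_self hε)
  have h1 : |f' i - f i| ≤ ‖f' - f‖ := (f' - f).abs_apply_le i
  have h2 := abs_le.1 (f.abs_apply_le i)
  have h3 := abs_le.1 h1
  have := h (f' i) ⟨by linarith, by linarith⟩ (f i) ⟨by linarith, by linarith⟩
    (by rw [Real.dist_eq]; exact lt_of_le_of_lt h1 hf'.1)
  rw [Real.dist_eq] at this
  exact this.le

theorem hasFDerivAt_superposition {g : ℝ → ℝ} (hg : ContDiff ℝ 1 g) (f : LInf ι) :
    HasFDerivAt (superposition hg.continuous)
      (LInf.mulCLM (superposition (hg.continuous_deriv le_rfl) f)) f := by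
  rw [hasFDerivAt_iff_isLittleO_nhds_zero, Asymptotics.isLittleO_iff]
  intro ε hε
  obtain ⟨δ, hδ, h⟩ := exists_abs_linearization_le hg ‖f‖ hε
  filter_upwards [Metric.ball_mem_nhds 0 hδ] with x hx
  rw [mem_ball_zero_iff] at hx
  refine lp.norm_le_of_forall_le (by positivity) fun i => ?_
  have := h (f i) (x i) (f.abs_apply_le i) ((x.abs_apply_le i).trans_lt hx)
  exact this.trans (mul_le_mul_of_nonneg_left (x.abs_apply_le i) hε.le)

theorem contDiff_superposition {n : ℕ} : ∀ {g : ℝ → ℝ} (hg : ContDiff ℝ n g),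
    ContDiff ℝ n (superposition hg.continuous : LInf ι → LInf ι) := by
  induction n with
  | zero =>
    intro g hg
    exact contDiff_zero.2 (continuous_superposition hg.continuous)
  | succ n ih =>
    intro g hg
    have hg' : ContDiff ℝ n (deriv g) := (contDiff_succ_iff_deriv.1 (by exact_mod_cast hg)).2.2
    have hg1 : ContDiff ℝ 1 g := hg.of_le (by exact_mod_cast Nat.le_add_left 1 n)
    have hc : Continuous g := hg.continuous
    change ContDiff ℝ (n + 1 : ℕ) (superposition hc)
    rw [Nat.cast_add, Nat.cast_one, contDiff_succ_iff_hasFDerivAt]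
    exact ⟨fun f => LInf.mulCLM (superposition hg'.continuous f),
      (LInf.mulCLM (ι := ι)).contDiff.comp (ih hg'), fun f => hasFDerivAt_superposition hg1 f⟩

/-! ### The nonlinear part of the energy as a functional on `ℓ²` -/

/-- The renormalised energy `∑ᵢ [φ(aᵢ + xᵢ) - φ(aᵢ) - aᵢ xᵢ]` of a finite energy perturbation `x` of
the strains `a`. Subtracting the linear term makes the series converge absolutely, as soon as
`φ' ∘ a - a` is square summable. -/
def renormEnergy (φ : ℝ → ℝ) (a : ι → ℝ) (x : L2 ι) : ℝ :=
  ∑' i, (φ (a i + x i) - φ (a i) - a i * x i)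

/-- The `ℓ²` gradient `φ' ∘ (a + x) - a` of `renormEnergy`; the junk value `0` is taken when this
family is not square summable. -/
def renormForce (φ : ℝ → ℝ) (a : ι → ℝ) (x : L2 ι) : L2 ι :=
  open Classical in
  if h : Memℓp (fun i => deriv φ (a i + x i) - a i) 2 then ⟨_, h⟩ else 0

section

variable {φ : ℝ → ℝ} {a : LInf ι}

theorem abs_add_apply_le (a : LInf ι) (x : L2 ι) (i : ι) : |a i + x i| ≤ ‖a‖ + ‖x‖ :=
  (abs_add_le _ _).trans (add_le_add (a.abs_apply_le i) (x.abs_apply_le i))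

theorem contDiff_one_deriv (hφ : ContDiff ℝ 2 φ) : ContDiff ℝ 1 (deriv φ) := by
  have : ContDiff ℝ (1 + 1) φ := by simpa [one_add_one_eq_two] using hφ
  exact (contDiff_succ_iff_deriv.1 this).2.2

theorem memℓp_force (hφ : ContDiff ℝ 2 φ) (ha : Memℓp (fun i => deriv φ (a i) - a i) 2)
    (x : L2 ι) : Memℓp (fun i => deriv φ (a i + x i) - a i) 2 := by
  obtain ⟨C, hC0, hC⟩ := exists_abs_sub_le (contDiff_one_deriv hφ) (‖a‖ + ‖x‖)
  have h1 : Memℓp (fun i => deriv φ (a i + x i) - deriv φ (a i)) 2 := by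
    refine memℓp_two_of_abs_le (G := fun i => C * |x i|) ?_ fun i => ?_
    · simpa [mul_pow] using x.summable_sq.mul_left (C ^ 2)
    · simpa using hC (a i) (a i + x i)
        ((a.abs_apply_le i).trans (le_add_of_nonneg_right (norm_nonneg x))) (abs_add_apply_le a x i)
  have h2 := h1.add ha
  have e : ((fun i => deriv φ (a i + x i) - deriv φ (a i)) + fun i => deriv φ (a i) - a i)
      = fun i => deriv φ (a i + x i) - a i := by
    funext i; simp
  rwa [e] at h2

theorem renormForce_apply (hφ : ContDiff ℝ 2 φ) (ha : Memℓp (fun i => deriv φ (a i) - a i) 2)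
    (x : L2 ι) (i : ι) : renormForce φ a x i = deriv φ (a i + x i) - a i := by
  rw [renormForce, dif_pos (memℓp_force hφ ha x)]

theorem summable_renormEnergy (hφ : ContDiff ℝ 2 φ)
    (ha : Memℓp (fun i => deriv φ (a i) - a i) 2) (x : L2 ι) :
    Summable fun i => φ (a i + x i) - φ (a i) - a i * x i := by
  obtain ⟨C, hC0, hC⟩ := exists_abs_linearization_le_sq hφ (‖a‖ + ‖x‖)
  have h1 : Summable fun i => φ (a i + x i) - φ (a i) - deriv φ (a i) * x i :=
    Summable.of_norm_bounded (x.summable_sq.mul_left C) fun i =>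
      hC (a i) (x i) ((a.abs_apply_le i).trans (le_add_of_nonneg_right (norm_nonneg x)))
        (abs_add_apply_le a x i)
  have h2 := L2.summable_mul ⟨_, ha⟩ x
  exact (h1.add h2).congr fun i => by ring

theorem hasFDerivAt_renormEnergy (hφ : ContDiff ℝ 2 φ)
    (ha : Memℓp (fun i => deriv φ (a i) - a i) 2) (x : L2 ι) :
    HasFDerivAt (renormEnergy φ a) (innerSL ℝ (renormForce φ a x)) x := by
  obtain ⟨C, hC0, hC⟩ := exists_abs_linearization_le_sq hφ (‖a‖ + ‖x‖ + 1)
  have hquad : ∀ h : L2 ι, ‖h‖ ≤ 1 → |renormEnergy φ a (x + h) - renormEnergy φ a x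
      - inner ℝ (renormForce φ a x) h| ≤ C * ‖h‖ ^ 2 := fun h hh => by
    have hs := ((summable_renormEnergy hφ ha (x + h)).sub (summable_renormEnergy hφ ha x)).sub
      ((renormForce φ a x).summable_mul h)
    have e : renormEnergy φ a (x + h) - renormEnergy φ a x - inner ℝ (renormForce φ a x) h
        = ∑' i, (φ (a i + x i + h i) - φ (a i + x i) - deriv φ (a i + x i) * h i) := by
      rw [L2.inner_eq_tsum_mul, renormEnergy, renormEnergy,
        ← (summable_renormEnergy hφ ha (x + h)).tsum_sub (summable_renormEnergy hφ ha x),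
        ← ((summable_renormEnergy hφ ha (x + h)).sub (summable_renormEnergy hφ ha x)).tsum_sub
          ((renormForce φ a x).summable_mul h)]
      refine tsum_congr fun i => ?_
      rw [renormForce_apply hφ ha, lp.coeFn_add, Pi.add_apply, ← add_assoc]
      ring
    rw [e, L2.norm_sq_eq_tsum, ← tsum_mul_left, ← Real.norm_eq_abs]
    refine tsum_of_norm_bounded (h.summable_sq.mul_left C).hasSum fun i => ?_
    refine hC _ _ ((abs_add_apply_le a x i).trans (by linarith)) ?_
    exact (abs_add_le _ _).trans (add_le_add (abs_add_apply_le a x i) ((h.abs_apply_le i).trans hh))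
  rw [hasFDerivAt_iff_isLittleO_nhds_zero]
  have hO : (fun h => renormEnergy φ a (x + h) - renormEnergy φ a x
      - innerSL ℝ (renormForce φ a x) h) =O[𝓝 0] fun h : L2 ι => ‖h‖ ^ 2 := by
    refine Asymptotics.IsBigO.of_bound C ?_
    filter_upwards [Metric.closedBall_mem_nhds 0 one_pos] with h hh
    rw [mem_closedBall_zero_iff] at hh
    simpa using hquad h hh
  exact hO.trans_isLittleO <| Asymptotics.isLittleO_norm_pow_id (E' := L2 ι) one_lt_two

/-- The coefficients `φ''(a + x)` of the Hessian of `renormEnergy`. -/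
def hessianCoeff (hφ : ContDiff ℝ 2 φ) (a : LInf ι) (x : L2 ι) : LInf ι :=
  superposition ((contDiff_one_deriv hφ).continuous_deriv le_rfl) (a + x.toLInf)

theorem hasFDerivAt_renormForce (hφ : ContDiff ℝ 2 φ)
    (ha : Memℓp (fun i => deriv φ (a i) - a i) 2) (x : L2 ι) :
    HasFDerivAt (renormForce φ a) (L2.mulCLM (hessianCoeff hφ a x)) x := by
  rw [hasFDerivAt_iff_isLittleO_nhds_zero, Asymptotics.isLittleO_iff]
  intro ε hε
  obtain ⟨δ, hδ, h⟩ := exists_abs_linearization_le (contDiff_one_deriv hφ) (‖a‖ + ‖x‖) hε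
  filter_upwards [Metric.ball_mem_nhds 0 hδ] with y hy
  rw [mem_ball_zero_iff] at hy
  refine L2.norm_le_of_abs_le hε.le fun i => ?_
  have := h (a i + x i) (y i) (abs_add_apply_le a x i) ((y.abs_apply_le i).trans_lt hy)
  have e : (renormForce φ a (x + y) - renormForce φ a x - L2.mulCLM (hessianCoeff hφ a x) y) i
      = deriv φ (a i + x i + y i) - deriv φ (a i + x i) - deriv (deriv φ) (a i + x i) * y i := by
    have e1 : (renormForce φ a (x + y) - renormForce φ a x - L2.mulCLM (hessianCoeff hφ a x) y) i
      = renormForce φ a (x + y) i - renormForce φ a x i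
        - deriv (deriv φ) (a i + x i) * y i := rfl
    rw [e1, renormForce_apply hφ ha, renormForce_apply hφ ha, lp.coeFn_add, Pi.add_apply,
      ← add_assoc]
    ring
  rw [e]
  exact this

theorem contDiff_renormEnergy {n : ℕ} (hφ : ContDiff ℝ (n + 2 : ℕ) φ)
    (ha : Memℓp (fun i => deriv φ (a i) - a i) 2) : ContDiff ℝ (n + 2 : ℕ) (renormEnergy φ a) := by
  have h2 : ContDiff ℝ 2 φ := hφ.of_le (by exact_mod_cast Nat.le_add_left 2 n)
  have hφ1 : ContDiff ℝ (n + 1 : ℕ) (deriv φ) :=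
    (contDiff_succ_iff_deriv.1 (by exact_mod_cast hφ)).2.2
  have hφ2 : ContDiff ℝ n (deriv (deriv φ)) :=
    (contDiff_succ_iff_deriv.1 (by exact_mod_cast hφ1)).2.2
  have hforce : ContDiff ℝ (n + 1 : ℕ) (renormForce φ a) := by
    rw [Nat.cast_add, Nat.cast_one, contDiff_succ_iff_hasFDerivAt]
    refine ⟨fun x => L2.mulCLM (hessianCoeff h2 a x), L2.mulCLM.contDiff.comp ?_,
      hasFDerivAt_renormForce h2 ha⟩
    exact (contDiff_superposition hφ2).comp (contDiff_const.add L2.toLInf.contDiff)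
  have e : ((n + 2 : ℕ) : WithTop ℕ∞) = ((n + 1 : ℕ) : WithTop ℕ∞) + 1 := by push_cast; rfl
  rw [e, contDiff_succ_iff_hasFDerivAt]
  exact ⟨fun x => innerSL ℝ (renormForce φ a x), (innerSL ℝ).contDiff.comp hforce,
    hasFDerivAt_renormEnergy h2 ha⟩

/-- Where `φ''` is within `1/2` of `1`, the force differs from the identity by a map with Lipschitz
constant `1/2`. -/
theorem norm_sub_sub_renormForce_le (hφ : ContDiff ℝ 2 φ)
    (ha : Memℓp (fun i => deriv φ (a i) - a i) 2) {δ : ℝ}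
    (hδ : ∀ t, |t| ≤ δ → |deriv (deriv φ) t - 1| ≤ 1 / 2) {x y : L2 ι}
    (hx : ‖a‖ + ‖x‖ ≤ δ) (hy : ‖a‖ + ‖y‖ ≤ δ) :
    ‖(x - y) - (renormForce φ a x - renormForce φ a y)‖ ≤ 1 / 2 * ‖x - y‖ := by
  refine L2.norm_le_of_abs_le (by norm_num) fun i => ?_
  have e : ((x - y) - (renormForce φ a x - renormForce φ a y)) i
      = x i - y i - (deriv φ (a i + x i) - deriv φ (a i + y i)) := by
    have e1 : ((x - y) - (renormForce φ a x - renormForce φ a y)) i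
      = x i - y i - (renormForce φ a x i - renormForce φ a y i) := rfl
    rw [e1, renormForce_apply hφ ha, renormForce_apply hφ ha]
    ring
  have key := (convex_Icc (-δ) δ).norm_image_sub_le_of_norm_hasDerivWithin_le
    (f := fun t => t - deriv φ t) (f' := fun t => 1 - deriv (deriv φ) t) (C := 1 / 2)
    (x := a i + y i) (y := a i + x i)
    (fun t _ => ((hasDerivAt_id t).sub
      ((contDiff_one_deriv hφ).differentiable one_ne_zero t).hasDerivAt).hasDerivWithinAt)
    (fun t ht => by
      rw [norm_sub_rev]; exact hδ t (abs_le.2 ht))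
    (abs_le.1 ((abs_add_apply_le a y i).trans hy)) (abs_le.1 ((abs_add_apply_le a x i).trans hx))
  have e2 : a i + x i - deriv φ (a i + x i) - (a i + y i - deriv φ (a i + y i))
      = x i - y i - (deriv φ (a i + x i) - deriv φ (a i + y i)) := by ring
  have e3 : a i + x i - (a i + y i) = x i - y i := by ring
  have e4 : (x - y) i = x i - y i := rfl
  rw [e, e4]
  simpa only [Real.norm_eq_abs, e2, e3] using key

end

/-! ### Scaling the reference strain -/

section

variable {φ : ℝ → ℝ} {a : LInf ι}

theorem memℓp_deriv_smul_sub (hφ : ContDiff ℝ 4 φ) (heven : ∀ r, φ (-r) = φ r)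
    (h2 : deriv (deriv φ) 0 = 1) (ha : Summable fun i => a i ^ 6) (ε : ℝ) :
    Memℓp (fun i => deriv φ ((ε • a) i) - (ε • a) i) 2 := by
  obtain ⟨C, hC0, hC⟩ := exists_abs_deriv_sub_id_le hφ heven h2 ‖ε • a‖
  refine memℓp_two_of_abs_le (G := fun i => C * |(ε • a) i| ^ 3) ?_
    fun i => hC _ ((ε • a).abs_apply_le i)
  refine (ha.mul_left (C ^ 2 * ε ^ 6)).congr fun i => ?_
  have e : (ε • a) i = ε * a i := rfl
  rw [mul_pow, ← pow_mul, Even.pow_abs (by decide), e]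
  ring

/-- The force at a fixed perturbation depends continuously on the loading parameter. -/
theorem continuous_renormForce_smul (hφ : ContDiff ℝ 4 φ) (heven : ∀ r, φ (-r) = φ r)
    (h2 : deriv (deriv φ) 0 = 1) (ha : Summable fun i => a i ^ 6) (x : L2 ι) :
    Continuous fun ε : ℝ => renormForce φ (ε • a) x := by
  have hφ2 : ContDiff ℝ 2 φ := hφ.of_le (by norm_num)
  refine continuous_iff_continuousAt.2 fun ε₀ => ?_
  set A := (|ε₀| + 1) * ‖a‖ with hA
  have hA0 : 0 ≤ A := by positivity
  obtain ⟨C, hC0, hC⟩ := exists_abs_deriv_sub_id_le hφ heven h2 (A + ‖x‖)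
  -- The force is `(φ'(t) - t) + x` with `t = ε a + x`, and `|φ'(t) - t| ≤ C |t|³`.
  refine L2.tendsto_of_dominated
    (G := fun i => C * (4 * ((|ε₀| + 1) ^ 3 * |a i| ^ 3 + ‖x‖ ^ 2 * |x i|)) + |x i|) ?_ ?_ ?_
  · have m1 : Memℓp (fun i => C * 4 * (|ε₀| + 1) ^ 3 * |a i| ^ 3) 2 := by
      refine memℓp_two_iff.2 ((ha.mul_left ((C * 4 * (|ε₀| + 1) ^ 3) ^ 2)).congr fun i => ?_)
      rw [mul_pow _ (|a i| ^ 3), ← pow_mul, Even.pow_abs (by decide)]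
    have m2 : Memℓp (fun i => (C * 4 * ‖x‖ ^ 2 + 1) * |x i|) 2 := by
      refine memℓp_two_iff.2 ((x.summable_sq.mul_left ((C * 4 * ‖x‖ ^ 2 + 1) ^ 2)).congr fun i => ?_)
      rw [mul_pow, sq_abs]
    refine (memℓp_two_iff.1 (m1.add m2)).congr fun i => ?_
    simp only [Pi.add_apply]
    ring
  · intro i
    have e : ∀ ε : ℝ, renormForce φ (ε • a) x i = deriv φ (ε * a i + x i) - ε * a i := fun ε =>
      renormForce_apply hφ2 (memℓp_deriv_smul_sub hφ heven h2 ha ε) x i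
    have hc : Continuous fun ε : ℝ => deriv φ (ε * a i + x i) - ε * a i := by
      have := (contDiff_one_deriv hφ2).continuous
      fun_prop
    simpa only [e] using hc.tendsto ε₀
  · filter_upwards [Metric.ball_mem_nhds ε₀ one_pos] with ε hε i
    have hε' : |ε| ≤ |ε₀| + 1 := by
      rw [Metric.mem_ball, Real.dist_eq] at hε
      have := abs_sub_abs_le_abs_sub ε ε₀
      linarith
    rw [renormForce_apply hφ2 (memℓp_deriv_smul_sub hφ heven h2 ha ε) x i]
    have e : (ε • a) i = ε * a i := rfl
    have ht1 : |(ε • a) i| ≤ (|ε₀| + 1) * |a i| := by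
      rw [e, abs_mul]; gcongr
    have ht : |(ε • a) i + x i| ≤ A + ‖x‖ :=
      (abs_add_le _ _).trans (add_le_add (ht1.trans (by rw [hA]; gcongr; exact a.abs_apply_le i))
        (x.abs_apply_le i))
    have h3 : |(ε • a) i + x i| ^ 3 ≤ 4 * ((|ε₀| + 1) ^ 3 * |a i| ^ 3 + ‖x‖ ^ 2 * |x i|) := by
      calc |(ε • a) i + x i| ^ 3 ≤ ((|ε₀| + 1) * |a i| + |x i|) ^ 3 :=
            pow_le_pow_left₀ (abs_nonneg _) ((abs_add_le _ _).trans (by linarith)) 3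
        _ ≤ 4 * (((|ε₀| + 1) * |a i|) ^ 3 + |x i| ^ 3) := by
            have := add_pow_le (a := (|ε₀| + 1) * |a i|) (b := |x i|) (by positivity)
              (abs_nonneg _) 3
            norm_num at this
            linarith
        _ ≤ _ := by
            rw [mul_pow]
            have : |x i| ^ 3 ≤ ‖x‖ ^ 2 * |x i| := by
              rw [pow_succ]
              gcongr
              exact x.abs_apply_le i
            linarith
    calc |deriv φ ((ε • a) i + x i) - (ε • a) i|
        = |(deriv φ ((ε • a) i + x i) - ((ε • a) i + x i)) + x i| := by congr 1; ring
      _ ≤ _ := (abs_add_le _ _).trans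
          (add_le_add ((hC _ ht).trans (mul_le_mul_of_nonneg_left h3 hC0)) le_rfl)

end

/-! ### Minimisers of functionals that are close to the quadratic one -/

section

variable {H : Type*} [NormedAddCommGroup H] [InnerProductSpace ℝ H]

/-- The derivative of `E` is a perturbation of the Riesz map with Lipschitz constant `1/2` on the closed
ball of radius `r`. -/
def NearRiesz (E : H → ℝ) (r : ℝ) : Prop :=
  ∀ u v : H, ‖u‖ ≤ r → ‖v‖ ≤ r →
    ‖innerSL ℝ (u - v) - (fderiv ℝ E u - fderiv ℝ E v)‖ ≤ 1 / 2 * ‖u - v‖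

variable {E : H → ℝ} {r : ℝ}

theorem NearRiesz.abs_le (h : NearRiesz E r) {u v : H} (hu : ‖u‖ ≤ r) (hv : ‖v‖ ≤ r) (w : H) :
    |inner ℝ (u - v) w - (fderiv ℝ E u w - fderiv ℝ E v w)| ≤ 1 / 2 * ‖u - v‖ * ‖w‖ :=
  ContinuousLinearMap.le_of_opNorm_le _ (h u v hu hv) w

theorem NearRiesz.strongly_monotone (h : NearRiesz E r) {u v : H} (hu : ‖u‖ ≤ r) (hv : ‖v‖ ≤ r) :
    1 / 2 * ‖u - v‖ ^ 2 ≤ fderiv ℝ E u (u - v) - fderiv ℝ E v (u - v) := by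
  have := (abs_sub_le_iff.1 (h.abs_le hu hv (u - v))).1
  rw [real_inner_self_eq_norm_sq] at this
  nlinarith

theorem NearRiesz.norm_sub_le (h : NearRiesz E r) {u v : H} (hu : ‖u‖ ≤ r) (hv : ‖v‖ ≤ r) :
    ‖u - v‖ ≤ 2 * ‖fderiv ℝ E u - fderiv ℝ E v‖ := by
  have h1 := norm_sub_norm_le (innerSL ℝ (u - v)) (fderiv ℝ E u - fderiv ℝ E v)
  rw [innerSL_apply_norm] at h1
  linarith [h u v hu hv]

/-- Two critical points in the ball coincide, since the derivative is strongly monotone there. -/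
theorem NearRiesz.critical_unique (h : NearRiesz E r) {u v : H} (hu : ‖u‖ ≤ r) (hv : ‖v‖ ≤ r)
    (cu : fderiv ℝ E u = 0) (cv : fderiv ℝ E v = 0) : u = v := by
  have := h.norm_sub_le hu hv
  rw [cu, cv, sub_zero, norm_zero, mul_zero] at this
  exact sub_eq_zero.1 (norm_le_zero_iff.1 this)

/-- Critical points are found as fixed points of the gradient descent map `u ↦ u - ∇E(u)`. -/
theorem NearRiesz.exists_critical [CompleteSpace H] (h : NearRiesz E r) (hr : 0 < r)
    (h0 : ‖fderiv ℝ E 0‖ ≤ r / 4) : ∃ u : H, ‖u‖ < r ∧ fderiv ℝ E u = 0 := by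
  set R := (InnerProductSpace.toDual ℝ H).symm
  set T : H → H := fun u => u - R (fderiv ℝ E u) with hT
  have hdiff : ∀ u v : H, ‖u‖ ≤ r → ‖v‖ ≤ r → ‖T u - T v‖ ≤ 1 / 2 * ‖u - v‖ := fun u v hu hv => by
    have e : T u - T v = R (innerSL ℝ (u - v) - (fderiv ℝ E u - fderiv ℝ E v)) := by
      have : R (innerSL ℝ (u - v)) = u - v :=
        (InnerProductSpace.toDual ℝ H).symm_apply_apply (u - v)
      rw [map_sub R, this, map_sub R]
      exact sub_sub_sub_comm _ _ _ _
    rw [e, LinearIsometryEquiv.norm_map]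
    exact h u v hu hv
  have hT0 : ‖T 0‖ ≤ r / 4 := by
    simpa [hT] using h0
  have hbound : ∀ u : H, ‖u‖ ≤ r → ‖T u‖ ≤ 3 / 4 * r := fun u hu => by
    have h1 := hdiff u 0 hu (by simpa using hr.le)
    have h2 := norm_sub_norm_le (T u) (T 0)
    rw [sub_zero] at h1
    linarith
  have hmaps : MapsTo T (Metric.closedBall 0 r) (Metric.closedBall 0 r) := fun u hu => by
    rw [mem_closedBall_zero_iff] at hu ⊢
    linarith [hbound u hu]
  have hcontr : ContractingWith (1 / 2) (hmaps.restrict T _ _) := by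
    refine ⟨by norm_num, LipschitzWith.of_dist_le_mul fun u v => ?_⟩
    have := hdiff u v (mem_closedBall_zero_iff.1 u.2) (mem_closedBall_zero_iff.1 v.2)
    rw [Subtype.dist_eq, Subtype.dist_eq, dist_eq_norm, dist_eq_norm]
    simpa using this
  obtain ⟨u, hu, hfix, -⟩ := hcontr.exists_fixedPoint' (x := 0)
    Metric.isClosed_closedBall.isComplete hmaps (by simpa using hr.le) (edist_ne_top _ _)
  rw [mem_closedBall_zero_iff] at hu
  refine ⟨u, ?_, ?_⟩
  · have := hbound u hu
    rw [hfix.eq] at this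
    linarith
  · have hz : R (fderiv ℝ E u) = 0 := by
      have : u - R (fderiv ℝ E u) = u := hfix
      simpa using this
    exact (LinearIsometryEquiv.map_eq_zero_iff R).1 hz

theorem NearRiesz.lt_of_critical (h : NearRiesz E r) (hE : Differentiable ℝ E) {u v : H}
    (hu : ‖u‖ < r) (hv : ‖v‖ < r) (cu : fderiv ℝ E u = 0) (hne : v ≠ u) : E u < E v := by
  have hline : ∀ t : ℝ, HasDerivAt (fun t : ℝ => E (u + t • (v - u)))
      (fderiv ℝ E (u + t • (v - u)) (v - u)) t := fun t => by
    refine (hE _).hasFDerivAt.comp_hasDerivAt t ?_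
    simpa using ((hasDerivAt_id t).smul_const (v - u)).const_add u
  obtain ⟨t, ht, he⟩ := exists_hasDerivAt_eq_slope _ _ zero_lt_one
    (continuous_iff_continuousAt.2 fun t => (hline t).continuousAt).continuousOn
    fun t _ => hline t
  have hw : ‖u + t • (v - u)‖ ≤ r := by
    have := (convex_ball (0 : H) r).add_smul_sub_mem (mem_ball_zero_iff.2 hu)
      (mem_ball_zero_iff.2 hv) ⟨ht.1.le, ht.2.le⟩
    exact (mem_ball_zero_iff.1 this).le
  have hm := h.strongly_monotone hw hu.le
  rw [add_sub_cancel_left, cu, map_smul, he, norm_smul] at hm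
  have hn : 0 < ‖v - u‖ := norm_pos_iff.2 (sub_ne_zero.2 hne)
  simp only [one_smul, zero_smul, add_zero, sub_zero, div_one, add_sub_cancel, smul_eq_mul,
    zero_apply, Real.norm_eq_abs, abs_of_pos ht.1] at hm
  have hpos : 0 < t * (E v - E u) := lt_of_lt_of_le (by have := ht.1; positivity) hm
  exact sub_pos.1 (pos_of_mul_pos_right hpos ht.1.le)

theorem NearRiesz.le_fderiv_fderiv (h : NearRiesz E r) (hE : ContDiff ℝ 2 E) {u : H}
    (hu : ‖u‖ < r) (v : H) : 1 / 2 * ‖v‖ ^ 2 ≤ fderiv ℝ (fderiv ℝ E) u v v := by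
  have hd : HasFDerivAt (fderiv ℝ E) (fderiv ℝ (fderiv ℝ E) u) u :=
    ((hE.fderiv_right (m := 1) (by norm_num [one_add_one_eq_two])).differentiable
      one_ne_zero u).hasFDerivAt
  have hlip : LipschitzOnWith (1 / 2) (fun x => innerSL ℝ x - fderiv ℝ E x)
      (Metric.ball (0 : H) r) := by
    refine LipschitzOnWith.of_dist_le_mul fun x hx y hy => ?_
    have := h x y (mem_ball_zero_iff.1 hx).le (mem_ball_zero_iff.1 hy).le
    rw [dist_eq_norm, dist_eq_norm, sub_sub_sub_comm, ← map_sub]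
    simpa using this
  have hn := ((innerSL ℝ (E := H)).hasFDerivAt.sub hd).le_of_lipschitzOn
    (Metric.isOpen_ball.mem_nhds (mem_ball_zero_iff.2 hu)) hlip
  have h2 := ContinuousLinearMap.le_of_opNorm_le_of_le _
    (ContinuousLinearMap.le_of_opNorm_le _ hn v) (le_refl ‖v‖)
  have h3 := (abs_sub_le_iff.1 h2).1
  have e : innerSL ℝ v v = ‖v‖ ^ 2 := real_inner_self_eq_norm_sq v
  have e' : ((1 / 2 : NNReal) : ℝ) = 1 / 2 := by simp
  change innerSL ℝ v v - fderiv ℝ (fderiv ℝ E) u v v ≤ _ at h3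
  rw [e, e'] at h3
  nlinarith

/-- A branch of strict local minimisers of a family of functionals whose derivatives are close to
the Riesz map, small at the origin and continuous in the parameter. -/
theorem exists_branch_of_nearRiesz [CompleteSpace H] {E : ℝ → H → ℝ} {r ε₀ : ℝ} (hr : 0 < r)
    (hE : ∀ ε, ContDiff ℝ 2 (E ε)) (hR : ∀ ε ∈ Ioo (-ε₀) ε₀, NearRiesz (E ε) r)
    (h0 : ∀ ε ∈ Ioo (-ε₀) ε₀, ‖fderiv ℝ (E ε) 0‖ ≤ r / 4)
    (hc : ∀ u, Continuous fun ε => fderiv ℝ (E ε) u) :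
    ∃ ubar : ℝ → H, ContinuousOn ubar (Ioo (-ε₀) ε₀) ∧ ∀ ε ∈ Ioo (-ε₀) ε₀,
      ubar ε ∈ Metric.ball (0 : H) r ∧
      (∀ u ∈ Metric.ball (0 : H) r, fderiv ℝ (E ε) u = 0 ↔ u = ubar ε) ∧
      (∀ u ∈ Metric.ball (0 : H) r, u ≠ ubar ε → E ε (ubar ε) < E ε u) ∧
      (∀ v : H, 1 / 2 * ‖v‖ ^ 2 ≤ fderiv ℝ (fderiv ℝ (E ε)) (ubar ε) v v) := by
  have hex : ∀ ε, ∃ u : H, ε ∈ Ioo (-ε₀) ε₀ → ‖u‖ < r ∧ fderiv ℝ (E ε) u = 0 := fun ε => by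
    by_cases hε : ε ∈ Ioo (-ε₀) ε₀
    · obtain ⟨u, hu⟩ := (hR ε hε).exists_critical hr (h0 ε hε)
      exact ⟨u, fun _ => hu⟩
    · exact ⟨0, fun h => absurd h hε⟩
  choose ubar hubar using hex
  refine ⟨ubar, fun ε₁ hε₁ => ?_, fun ε hε => ?_⟩
  · -- Strong monotonicity controls `ubar ε - ubar ε₁` by the residual of `ubar ε₁` at parameter `ε`.
    refine ContinuousAt.continuousWithinAt ?_
    rw [ContinuousAt, tendsto_iff_norm_sub_tendsto_zero]
    have hlim : Tendsto (fun ε => 2 * ‖fderiv ℝ (E ε) (ubar ε₁)‖) (𝓝 ε₁) (𝓝 0) := by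
      have := ((hc (ubar ε₁)).norm.const_mul 2).tendsto ε₁
      simpa [(hubar ε₁ hε₁).2] using this
    refine squeeze_zero' (Eventually.of_forall fun _ => norm_nonneg _) ?_ hlim
    filter_upwards [Ioo_mem_nhds hε₁.1 hε₁.2] with ε hε
    have := (hR ε hε).norm_sub_le (hubar ε hε).1.le (hubar ε₁ hε₁).1.le
    rwa [(hubar ε hε).2, zero_sub, norm_neg] at this
  · obtain ⟨hb, hcrit⟩ := hubar ε hε
    refine ⟨mem_ball_zero_iff.2 hb, fun u hu => ⟨fun h => ?_, fun h => h ▸ hcrit⟩,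
      fun u hu hne => ?_, (hR ε hε).le_fderiv_fderiv (hE ε) hb⟩
    · exact (hR ε hε).critical_unique (mem_ball_zero_iff.1 hu).le hb.le h hcrit
    · exact (hR ε hε).lt_of_critical ((hE ε).differentiable two_ne_zero) hb
        (mem_ball_zero_iff.1 hu) hcrit hne

end

/-! ### Bonds of the cracked lattice -/

theorem mem_upperFace {m : Site} : m ∈ upperFace ↔ m.1 ≤ 0 ∧ m.2 = 1 := by
  simp only [upperFace, pos, mem_ofPred_eq]
  refine and_congr ⟨fun h => ?_, fun h => ?_⟩ ⟨fun h => ?_, fun h => ?_⟩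
  · have : (m.1 : ℝ) < 1 := by linarith
    exact Int.lt_add_one_iff.1 (by exact_mod_cast this)
  · have : (m.1 : ℝ) ≤ 0 := by exact_mod_cast h
    linarith
  · have : (m.2 : ℝ) = 1 := by linarith
    exact_mod_cast this
  · rw [h]; norm_num

theorem mem_lowerFace {m : Site} : m ∈ lowerFace ↔ m.1 ≤ 0 ∧ m.2 = 0 := by
  simp only [lowerFace, pos, mem_ofPred_eq]
  refine and_congr ⟨fun h => ?_, fun h => ?_⟩ ⟨fun h => ?_, fun h => ?_⟩
  · have : (m.1 : ℝ) < 1 := by linarith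
    exact Int.lt_add_one_iff.1 (by exact_mod_cast this)
  · have : (m.1 : ℝ) ≤ 0 := by exact_mod_cast h
    linarith
  · have : (m.2 : ℝ) = 0 := by linarith
    exact_mod_cast this
  · rw [h]; norm_num

theorem mem_dirsAt {m : Site} {ρ : ℤ × ℤ} : ρ ∈ dirsAt m ↔ ρ ∈ dirs ∧
    ¬ (m.1 ≤ 0 ∧ m.2 = 1 ∧ ρ = (0, -1)) ∧ ¬ (m.1 ≤ 0 ∧ m.2 = 0 ∧ ρ = (0, 1)) := by
  unfold dirsAt
  split_ifs with h1 h2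
  · rw [mem_upperFace] at h1
    simp [h1.1, h1.2]
  · rw [mem_lowerFace] at h2
    simp [h2.1, h2.2]
  · rw [mem_upperFace] at h1
    rw [mem_lowerFace] at h2
    tauto

theorem mem_dirs {ρ : ℤ × ℤ} :
    ρ ∈ dirs ↔ ρ = (1, 0) ∨ ρ = (0, 1) ∨ ρ = (-1, 0) ∨ ρ = (0, -1) := by
  simp [dirs]

theorem neg_mem_dirs {ρ : ℤ × ℤ} (h : ρ ∈ dirs) : -ρ ∈ dirs := by
  rw [mem_dirs] at h
  rcases h with rfl | rfl | rfl | rfl <;> simp [dirs]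

theorem neg_mem_dirsAt {m : Site} {ρ : ℤ × ℤ} (h : ρ ∈ dirsAt m) : -ρ ∈ dirsAt (m + ρ) := by
  rw [mem_dirsAt] at h ⊢
  obtain ⟨h0, h1, h2⟩ := h
  refine ⟨neg_mem_dirs h0, ?_, ?_⟩
  · rintro ⟨ha, hb, hc⟩
    obtain rfl : ρ = (0, 1) := by rw [← neg_neg ρ, hc]; rfl
    simp only [Prod.fst_add, Prod.snd_add] at ha hb
    exact h2 ⟨by omega, by omega, rfl⟩
  · rintro ⟨ha, hb, hc⟩
    obtain rfl : ρ = (0, -1) := by rw [← neg_neg ρ, hc]; rfl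
    simp only [Prod.fst_add, Prod.snd_add] at ha hb
    exact h1 ⟨by omega, by omega, rfl⟩

/-- Oriented bonds, those crossing the crack included. -/
abbrev Bond : Type := Site × dirs

/-- The finite difference of `u` along a bond, which is `0` if the bond crosses the crack. -/
def strain (u : Site → ℝ) (b : Bond) : ℝ := grad u b.1 b.2

theorem strain_of_mem (u : Site → ℝ) {b : Bond} (h : (b.2 : ℤ × ℤ) ∈ dirsAt b.1) :
    strain u b = u (b.1 + b.2) - u b.1 := by
  simp [strain, grad, h]

theorem strain_of_notMem (u : Site → ℝ) {b : Bond} (h : (b.2 : ℤ × ℤ) ∉ dirsAt b.1) :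
    strain u b = 0 := by
  simp [strain, grad, h]

theorem abs_strain_le {u : Site → ℝ} {b : Bond} {C : ℝ} (hC : 0 ≤ C)
    (h : (b.2 : ℤ × ℤ) ∈ dirsAt b.1 → |u (b.1 + b.2) - u b.1| ≤ C) : |strain u b| ≤ C := by
  by_cases hb : (b.2 : ℤ × ℤ) ∈ dirsAt b.1
  · rw [strain_of_mem u hb]; exact h hb
  · rw [strain_of_notMem u hb, abs_zero]; exact hC

theorem norm_grad_sq (u : Site → ℝ) (m : Site) :
    ‖grad u m‖ ^ 2 = ∑ ρ : dirs, strain u (m, ρ) ^ 2 := by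
  rw [EuclideanSpace.norm_sq_eq]
  simp [strain]

theorem summable_bond_of_summable_site {F : Site → ℝ} (hF : Summable F) (h0 : ∀ m, 0 ≤ F m) :
    Summable fun b : Bond => F b.1 := by
  have h1 : Summable fun _ : dirs => (1 : ℝ) := (hasSum_fintype _).summable
  simpa using hF.mul_of_nonneg h1 h0 fun _ => zero_le_one

theorem hasSum_strain_sq {u : Site → ℝ} (h : Memℓp (grad u) 2) :
    HasSum (fun b => strain u b ^ 2) (∑' m, ‖grad u m‖ ^ 2) := by
  have hs : Summable fun m => ‖grad u m‖ ^ 2 := by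
    have := (memℓp_gen_iff (p := 2) (by norm_num)).1 h
    simpa using this
  have hb : Summable fun b : Bond => strain u b ^ 2 := by
    refine (summable_bond_of_summable_site hs fun m => sq_nonneg _).of_nonneg_of_le
      (fun b => sq_nonneg _) fun b => ?_
    rw [norm_grad_sq]
    exact Finset.single_le_sum (f := fun ρ : dirs => strain u (b.1, ρ) ^ 2)
      (fun _ _ => sq_nonneg _) (Finset.mem_univ b.2)
  have e : ∑' m, ‖grad u m‖ ^ 2 = ∑' b : Bond, strain u b ^ 2 := by
    rw [hb.tsum_prod]
    exact tsum_congr fun m => by rw [norm_grad_sq, tsum_fintype]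
  rw [e]
  exact hb.hasSum

theorem memℓp_grad {u : Site → ℝ} (h : Summable fun b => strain u b ^ 2) : Memℓp (grad u) 2 := by
  rw [memℓp_gen_iff (by norm_num)]
  refine h.prod.congr fun m => ?_
  rw [tsum_fintype, ← norm_grad_sq]
  simp

/-! ### The energy space as a Hilbert space -/

/-- The isometric embedding `u ↦ Du` of the energy space into `ℓ²` of the bonds. -/
def strainL2 : H1 →ₗᵢ[ℝ] L2 Bond where
  toFun u := ⟨strain u.disp, memℓp_two_iff.2 (hasSum_strain_sq u.property.1).summable⟩
  map_add' u v := Subtype.ext (funext fun b =>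
    congrArg (fun g : Stencil => g b.2) (congrFun (grad_add u.disp v.disp) b.1))
  map_smul' c u := Subtype.ext (funext fun b =>
    congrArg (fun g : Stencil => g b.2) (congrFun (grad_smul c u.disp) b.1))
  norm_map' u := by
    rw [← sq_eq_sq₀ (norm_nonneg _) (norm_nonneg _), L2.norm_sq_eq_tsum, norm_sq_eq]
    exact (hasSum_strain_sq u.property.1).tsum_eq

theorem H1.summable_strain_sq (u : H1) : Summable fun b => strain u.disp b ^ 2 :=
  (strainL2 u).summable_sq

/-- A displacement with square summable strains, normalised at the reference site, as an element of
the energy space. -/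
def H1.ofDisp (u : Site → ℝ) (h : Summable fun b => strain u b ^ 2) (h0 : u refSite = 0) : H1 :=
  (⟨u, memℓp_grad h, h0⟩ : energySubmodule)

/-- The inner product `⟨Du, Dv⟩`, which induces the energy norm. -/
instance : InnerProductSpace ℝ H1 where
  inner u v := inner ℝ (strainL2 u) (strainL2 v)
  norm_sq_eq_re_inner u := by
    rw [← strainL2.norm_map u]
    exact norm_sq_eq_re_inner (𝕜 := ℝ) (strainL2 u)
  conj_inner_symm u v := inner_conj_symm (𝕜 := ℝ) (strainL2 u) (strainL2 v)
  add_left u v w := by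
    change inner ℝ (strainL2 (u + v)) _ = _
    rw [map_add, inner_add_left]
  smul_left u v c := by
    change inner ℝ (strainL2 (c • u)) _ = _
    rw [map_smul, inner_smul_left]

theorem H1.abs_strain_le_norm (u : H1) (b : Bond) : |strain u.disp b| ≤ ‖u‖ := by
  rw [← strainL2.norm_map u]
  exact (strainL2 u).abs_apply_le b

theorem H1.abs_step_le_norm (u : H1) {m : Site} {ρ : ℤ × ℤ} (h : ρ ∈ dirsAt m) :
    |u.disp (m + ρ) - u.disp m| ≤ ‖u‖ := by
  have hρ : ρ ∈ dirs := (mem_dirsAt.1 h).1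
  have := u.abs_strain_le_norm (m, ⟨ρ, hρ⟩)
  rwa [strain_of_mem (b := (m, ⟨ρ, hρ⟩)) _ h] at this

theorem abs_sub_le_mul_of_step {f : ℤ → ℝ} {C : ℝ} (hf : ∀ a, |f (a + 1) - f a| ≤ C) (a : ℤ) :
    |f a - f 1| ≤ |(a : ℝ) - 1| * C := by
  have hnat : ∀ (b : ℤ) (n : ℕ), |f (b + n) - f b| ≤ n * C := fun b n => by
    induction n with
    | zero => simp
    | succ n ih =>
      have h1 := hf (b + n)
      have h2 := abs_add_le (f (b + n + 1) - f (b + n)) (f (b + n) - f b)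
      rw [sub_add_sub_cancel] at h2
      push_cast
      rw [← add_assoc]
      linarith
  rcases le_total 1 a with h | h
  · obtain ⟨n, rfl⟩ := Int.le.dest h
    have e : |((1 + n : ℤ) : ℝ) - 1| = n := by push_cast; simp
    rw [e]
    exact hnat 1 n
  · obtain ⟨n, hn⟩ := Int.le.dest h
    have h1 := hnat a n
    have h2 : (n : ℝ) = 1 - a := by
      have : (n : ℤ) = 1 - a := by omega
      exact_mod_cast this
    rw [hn, abs_sub_comm] at h1
    rw [abs_sub_comm (a : ℝ) 1, ← h2, Nat.abs_cast]
    exact h1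

theorem H1.disp_refSite (u : H1) : u.disp refSite = 0 := u.property.2

/-- Displacements of finite energy grow at most linearly, since they can be summed along a path from
the reference site that avoids the crack. -/
theorem H1.abs_disp_le (u : H1) (m : Site) :
    |u.disp m| ≤ (|(m.1 : ℝ) - 1| + |(m.2 : ℝ) - 1|) * ‖u‖ := by
  obtain ⟨a, b⟩ := m
  have h0 : u.disp (1, 1) = 0 := u.disp_refSite
  have hx : |u.disp (a, b) - u.disp (1, b)| ≤ |(a : ℝ) - 1| * ‖u‖ := by
    refine abs_sub_le_mul_of_step (f := fun a => u.disp (a, b)) (fun a => ?_) a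
    simpa using u.abs_step_le_norm (horizontal_mem_dirsAt (a, b))
  have hy : |u.disp (1, b) - u.disp (1, 1)| ≤ |(b : ℝ) - 1| * ‖u‖ := by
    refine abs_sub_le_mul_of_step (f := fun b => u.disp (1, b)) (fun b => ?_) b
    simpa using u.abs_step_le_norm (vertical_mem_dirsAt b)
  rw [h0, sub_zero] at hy
  calc |u.disp (a, b)| = |(u.disp (a, b) - u.disp (1, b)) + u.disp (1, b)| := by
        rw [sub_add_cancel]
    _ ≤ |u.disp (a, b) - u.disp (1, b)| + |u.disp (1, b)| := abs_add_le _ _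
    _ ≤ |(a : ℝ) - 1| * ‖u‖ + |(b : ℝ) - 1| * ‖u‖ := add_le_add hx hy
    _ = _ := (add_mul _ _ _).symm

theorem H1.disp_add (u v : H1) (m : Site) : (u + v).disp m = u.disp m + v.disp m := rfl

theorem H1.disp_sub (u v : H1) (m : Site) : (u - v).disp m = u.disp m - v.disp m := rfl

theorem H1.disp_smul (c : ℝ) (u : H1) (m : Site) : (c • u).disp m = c * u.disp m := rfl

theorem tendsto_strain {β : Type*} {l : Filter β} {f : β → Site → ℝ} {u : Site → ℝ}
    (h : ∀ m, Tendsto (fun n => f n m) l (𝓝 (u m))) (b : Bond) :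
    Tendsto (fun n => strain (f n) b) l (𝓝 (strain u b)) := by
  by_cases hb : (b.2 : ℤ × ℤ) ∈ dirsAt b.1
  · simp only [strain_of_mem _ hb]
    exact (h _).sub (h _)
  · simp only [strain_of_notMem _ hb]
    exact tendsto_const_nhds

instance : CompleteSpace H1 := by
  refine Metric.complete_of_cauchySeq_tendsto fun f hf => ?_
  obtain ⟨g, hg⟩ := cauchySeq_tendsto_of_complete
    (strainL2.isometry.uniformContinuous.comp_cauchySeq hf)
  have hpt : ∀ m, ∃ c, Tendsto (fun n => (f n).disp m) atTop (𝓝 c) := fun m => by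
    refine cauchySeq_tendsto_of_complete ?_
    refine UniformContinuous.comp_cauchySeq (f := fun u : H1 => u.disp m)
      (LipschitzWith.uniformContinuous (K := (|(m.1 : ℝ) - 1| + |(m.2 : ℝ) - 1|).toNNReal)
      (LipschitzWith.of_dist_le_mul fun u v => ?_)) hf
    rw [Real.dist_eq, dist_eq_norm, Real.coe_toNNReal _ (by positivity), ← H1.disp_sub]
    exact (u - v).abs_disp_le m
  choose u hu using hpt
  have hs : ∀ b, strain u b = g b := fun b => by
    refine tendsto_nhds_unique (tendsto_strain hu b) ?_
    exact ((lp.evalCLM ℝ (fun _ : Bond => ℝ) 2 b).continuous.tendsto g).comp hg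
  have hsq : Summable fun b => strain u b ^ 2 := by
    simpa only [hs] using g.summable_sq
  have h0 : u refSite = 0 := by
    refine tendsto_nhds_unique (hu refSite) ?_
    exact tendsto_const_nhds.congr fun n => (f n).disp_refSite.symm
  refine ⟨H1.ofDisp u hsq h0, ?_⟩
  rw [strainL2.isometry.isEmbedding.tendsto_nhds_iff]
  have e : strainL2 (H1.ofDisp u hsq h0) = g := lp.ext (funext hs)
  rw [e]
  exact hg

/-! ### A slowly growing function of finite energy -/

/-- The increments `1 / (n (⌊log₂ n⌋ + 1))`. -/
def slowIncrement (n : ℕ) : ℝ := 1 / (n * (Nat.log 2 n + 1))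

theorem slowIncrement_nonneg (n : ℕ) : 0 ≤ slowIncrement n := by
  unfold slowIncrement; positivity

theorem slowIncrement_anti {m n : ℕ} (hm : 0 < m) (h : m ≤ n) :
    slowIncrement n ≤ slowIncrement m := by
  unfold slowIncrement
  have h1 : Nat.log 2 m ≤ Nat.log 2 n := Nat.log_mono_right h
  have hm' : (0 : ℝ) < m := by exact_mod_cast hm
  gcongr

theorem slowIncrement_two_pow (k : ℕ) : 2 ^ k * slowIncrement (2 ^ k) = 1 / ((k : ℝ) + 1) := by
  unfold slowIncrement
  rw [Nat.log_pow one_lt_two]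
  push_cast
  field_simp

theorem not_summable_slowIncrement : ¬ Summable slowIncrement := by
  rw [← summable_condensed_iff_of_nonneg slowIncrement_nonneg fun m n => slowIncrement_anti]
  simp only [slowIncrement_two_pow]
  have h := (summable_nat_add_iff (f := fun n : ℕ => 1 / (n : ℝ)) 1).not.2
    Real.not_summable_one_div_natCast
  simpa using h

theorem summable_mul_slowIncrement_sq : Summable fun n : ℕ => (n : ℝ) * slowIncrement n ^ 2 := by
  have e : ∀ n : ℕ, (n : ℝ) * slowIncrement n ^ 2 = 1 / (n * ((Nat.log 2 n : ℝ) + 1) ^ 2) := by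
    intro n
    unfold slowIncrement
    rcases eq_or_ne n 0 with rfl | hn
    · simp
    · have : (n : ℝ) ≠ 0 := by exact_mod_cast hn
      field_simp
  rw [← summable_condensed_iff_of_nonneg]
  · have e2 : ∀ k : ℕ, (2 : ℝ) ^ k * (((2 ^ k : ℕ) : ℝ) * slowIncrement (2 ^ k) ^ 2)
        = 1 / ((k : ℝ) + 1) ^ 2 := fun k => by
      have := slowIncrement_two_pow k
      push_cast
      calc (2 : ℝ) ^ k * (2 ^ k * slowIncrement (2 ^ k) ^ 2)
          = (2 ^ k * slowIncrement (2 ^ k)) ^ 2 := by ring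
        _ = _ := by rw [this, one_div_pow]
    simp only [e2]
    have h := (summable_nat_add_iff (f := fun n : ℕ => 1 / (n : ℝ) ^ 2) 1).2
      (Real.summable_one_div_nat_pow.2 one_lt_two)
    simpa using h
  · intro n; positivity
  · intro m n hm h
    rw [e, e]
    have h1 : Nat.log 2 m ≤ Nat.log 2 n := Nat.log_mono_right h
    have hm' : (0 : ℝ) < m := by exact_mod_cast hm
    gcongr

/-- The supremum norm of the index of a site. -/
def siteNorm (m : Site) : ℕ := max m.1.natAbs m.2.natAbs

theorem summable_siteNorm {F : ℕ → ℝ} (h0 : ∀ n, 0 ≤ F n) (h : Summable fun n : ℕ => (n : ℝ) * F n) :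
    Summable fun m : Site => F (siteNorm m) := by
  have hbox : ∀ (n : ℕ) (m : Site), m ∈ Finset.box (α := Site) n → siteNorm m = n := fun n m hm => by
    simpa [siteNorm] using Int.mem_box.1 hm
  rw [summable_partition (fun m => h0 _) Int.existsUnique_mem_box]
  refine ⟨fun n => (hasSum_fintype (β := Finset.box (α := Site) n) _).summable, ?_⟩
  rw [← summable_nat_add_iff 1]
  refine (((summable_nat_add_iff 1).2 h).mul_left 8).congr fun n => ?_
  have e : ∀ m : Finset.box (α := Site) (n + 1), F (siteNorm m) = F (n + 1) := fun m => by
    rw [hbox _ m m.2]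
  have e2 : ∑' m : Finset.box (α := Site) (n + 1), F (siteNorm m) = 8 * (↑(n + 1) * F (n + 1)) := by
    simp only [e, tsum_fintype, Finset.univ_eq_attach, Finset.sum_const, Finset.card_attach,
      nsmul_eq_mul, Int.card_box n.succ_ne_zero]
    push_cast
    ring
  exact e2.symm

/-- A function on the lattice that tends to infinity and has square summable differences; it grows
like the iterated logarithm of the distance to the origin. -/
def slowFn (m : Site) : ℝ := ∑ j ∈ Finset.range (siteNorm m), slowIncrement (j + 1)

theorem slowFn_nonneg (m : Site) : 0 ≤ slowFn m :=
  Finset.sum_nonneg fun _ _ => slowIncrement_nonneg _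

theorem siteNorm_add_le (m : Site) {ρ : ℤ × ℤ} (hρ : ρ ∈ dirs) :
    siteNorm (m + ρ) ≤ siteNorm m + 1 ∧ siteNorm m ≤ siteNorm (m + ρ) + 1 := by
  rw [mem_dirs] at hρ
  rcases hρ with rfl | rfl | rfl | rfl <;>
    simp only [siteNorm, Prod.fst_add, Prod.snd_add] <;> omega

theorem abs_slowFn_sub_le (m : Site) {ρ : ℤ × ℤ} (hρ : ρ ∈ dirs) :
    |slowFn (m + ρ) - slowFn m| ≤ slowIncrement (max 1 (siteNorm m)) := by
  obtain ⟨h1, h2⟩ := siteNorm_add_le m hρ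
  unfold slowFn
  generalize siteNorm (m + ρ) = k at *
  generalize siteNorm m = n at *
  obtain rfl | rfl | h : k = n + 1 ∨ k = n ∨ n = k + 1 := by omega
  · rw [Finset.sum_range_succ, add_sub_cancel_left, abs_of_nonneg (slowIncrement_nonneg _)]
    exact slowIncrement_anti (by omega) (by omega)
  · simpa using slowIncrement_nonneg _
  · subst h
    rw [Finset.sum_range_succ, sub_add_cancel_left, abs_neg,
      abs_of_nonneg (slowIncrement_nonneg _), max_eq_right (by omega)]

theorem abs_strain_slowFn_le (b : Bond) :
    |strain slowFn b| ≤ slowIncrement (max 1 (siteNorm b.1)) :=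
  abs_strain_le (slowIncrement_nonneg _) fun _ => abs_slowFn_sub_le b.1 b.2.2

theorem summable_strain_slowFn_sq : Summable fun b => strain slowFn b ^ 2 := by
  have h1 : Summable fun n : ℕ => (n : ℝ) * slowIncrement (max 1 n) ^ 2 := by
    refine summable_mul_slowIncrement_sq.congr fun n => ?_
    rcases Nat.eq_zero_or_pos n with rfl | hn
    · simp
    · rw [max_eq_right hn]
  refine (summable_bond_of_summable_site (summable_siteNorm (fun n => sq_nonneg _) h1)
    fun m => sq_nonneg _).of_nonneg_of_le (fun b => sq_nonneg _) fun b => ?_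
  exact sq_le_sq' (by linarith [(abs_le.1 (abs_strain_slowFn_le b)).1])
    (abs_le.1 (abs_strain_slowFn_le b)).2

theorem finite_slowFn_lt (C : ℝ) : {m : Site | slowFn m < C}.Finite := by
  have hdiv : Tendsto (fun n => ∑ j ∈ Finset.range n, slowIncrement (j + 1)) atTop atTop :=
    (not_summable_iff_tendsto_nat_atTop_of_nonneg fun n => slowIncrement_nonneg _).1
      ((summable_nat_add_iff 1).not.2 not_summable_slowIncrement)
  obtain ⟨N, hN⟩ := (hdiv.eventually_ge_atTop C).exists_forall_of_atTop
  refine ((Set.finite_Icc (-(N : ℤ)) N).prod (Set.finite_Icc (-(N : ℤ)) N)).subset fun m hm => ?_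
  have : siteNorm m < N := by
    by_contra h
    exact absurd hm (not_lt.2 (hN _ (not_lt.1 h)))
  unfold siteNorm at this
  exact ⟨⟨by omega, by omega⟩, ⟨by omega, by omega⟩⟩

/-! ### Density of the finitely supported displacements -/

/-- The cut-off function `max 0 (1 - h / (n + 1))`, `h` being `slowFn`. -/
def cutoff (n : ℕ) (m : Site) : ℝ := max 0 (1 - slowFn m / (n + 1))

/-- Truncation of a number to the interval `[-(n + 1), n + 1]`. -/
def clamp (n : ℕ) (x : ℝ) : ℝ := max (-(n + 1)) (min (n + 1) x)

theorem abs_max_sub_max_le (a x y : ℝ) : |max a x - max a y| ≤ |x - y| := by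
  simpa using abs_max_sub_max_le_max a x a y

theorem abs_clamp_sub_le (n : ℕ) (x y : ℝ) : |clamp n x - clamp n y| ≤ |x - y| := by
  refine (abs_max_sub_max_le _ _ _).trans ?_
  simpa using abs_min_sub_min_le_max ((n : ℝ) + 1) x (n + 1) y

theorem abs_clamp_le (n : ℕ) (x : ℝ) : |clamp n x| ≤ n + 1 := by
  have : (0 : ℝ) ≤ n + 1 := by positivity
  exact abs_le.2 ⟨le_max_left _ _, max_le (by linarith) (min_le_left _ _)⟩

theorem abs_cutoff_sub_le (n : ℕ) (m m' : Site) :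
    |cutoff n m - cutoff n m'| ≤ |slowFn m - slowFn m'| / (n + 1) := by
  refine (abs_max_sub_max_le _ _ _).trans (le_of_eq ?_)
  have hn : (0 : ℝ) < n + 1 := by positivity
  rw [sub_sub_sub_cancel_left, ← sub_div, abs_div, abs_of_pos hn, abs_sub_comm]

theorem abs_cutoff_le_one (n : ℕ) (m : Site) : |cutoff n m| ≤ 1 := by
  have := slowFn_nonneg m
  have h : 0 ≤ slowFn m / (n + 1) := by positivity
  exact abs_le.2 ⟨by linarith [show 0 ≤ cutoff n m from le_max_left _ _],
    max_le zero_le_one (by linarith)⟩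

theorem finite_support_cutoff (n : ℕ) : (Function.support (cutoff n)).Finite := by
  refine (finite_slowFn_lt (n + 1)).subset fun m hm => ?_
  by_contra h
  refine hm (max_eq_left ?_)
  have hn : (0 : ℝ) < n + 1 := by positivity
  have : 1 ≤ slowFn m / (n + 1) := (one_le_div hn).2 (not_lt.1 h)
  linarith

/-- The finitely supported approximations of `u`: truncation at height `n + 1` is paired with a
cut-off of slope `1 / (n + 1)`, so that the strains are dominated independently of `n`. -/
def approx (u : Site → ℝ) (n : ℕ) (m : Site) : ℝ := cutoff n m * clamp n (u m)

theorem abs_strain_approx_le (u : Site → ℝ) (n : ℕ) (b : Bond) :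
    |strain (approx u n) b| ≤ |strain u b| + |strain slowFn b| := by
  refine abs_strain_le (by positivity) fun hb => ?_
  rw [strain_of_mem _ hb, strain_of_mem _ hb]
  generalize b.1 + (b.2 : ℤ × ℤ) = m'
  generalize b.1 = m
  have hn : (0 : ℝ) < n + 1 := by positivity
  have e : approx u n m' - approx u n m = cutoff n m' * (clamp n (u m') - clamp n (u m))
      + clamp n (u m) * (cutoff n m' - cutoff n m) := by unfold approx; ring
  rw [e]
  refine (abs_add_le _ _).trans (add_le_add ?_ ?_)
  · rw [abs_mul]
    calc _ ≤ 1 * |u m' - u m| := mul_le_mul (abs_cutoff_le_one n m') (abs_clamp_sub_le n _ _)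
          (abs_nonneg _) zero_le_one
      _ = _ := one_mul _
  · rw [abs_mul]
    calc _ ≤ ((n : ℝ) + 1) * (|slowFn m' - slowFn m| / (n + 1)) :=
          mul_le_mul (abs_clamp_le n _) (abs_cutoff_sub_le n _ _) (abs_nonneg _) hn.le
      _ = _ := by field_simp

theorem tendsto_approx (u : Site → ℝ) (m : Site) :
    Tendsto (fun n => approx u n m) atTop (𝓝 (u m)) := by
  have h1 : Tendsto (fun n : ℕ => cutoff n m) atTop (𝓝 1) := by
    have h := tendsto_one_div_add_atTop_nhds_zero_nat (𝕜 := ℝ)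
    have h' : Tendsto (fun n : ℕ => max 0 (1 - slowFn m * (1 / ((n : ℝ) + 1)))) atTop
        (𝓝 (max 0 (1 - slowFn m * 0))) :=
      tendsto_const_nhds.max (tendsto_const_nhds.sub (h.const_mul _))
    simpa [cutoff, div_eq_mul_inv] using h'
  have h2 : ∀ᶠ n : ℕ in atTop, clamp n (u m) = u m := by
    obtain ⟨N, hN⟩ := exists_nat_ge |u m|
    filter_upwards [eventually_ge_atTop N] with n hn
    have hn' : |u m| ≤ n := hN.trans (by exact_mod_cast hn)
    have := abs_le.1 hn'
    rw [clamp, min_eq_right (by linarith), max_eq_right (by linarith)]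
  have h3 := h1.mul_const (u m)
  rw [one_mul] at h3
  refine h3.congr' ?_
  filter_upwards [h2] with n hn
  rw [approx, hn]

theorem dense_compactlySupported : Dense compactlySupported := by
  intro u
  have hG : Summable fun b => (|strain u.disp b| + |strain slowFn b|) ^ 2 := by
    have h1 : Memℓp (fun b => |strain u.disp b|) 2 :=
      memℓp_two_iff.2 (by simpa only [sq_abs] using u.summable_strain_sq)
    have h2 : Memℓp (fun b => |strain slowFn b|) 2 :=
      memℓp_two_iff.2 (by simpa using summable_strain_slowFn_sq)
    exact memℓp_two_iff.1 (h1.add h2)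
  have hs : ∀ n, Summable fun b => strain (approx u.disp n) b ^ 2 := fun n =>
    memℓp_two_iff.1 (memℓp_two_of_abs_le hG (abs_strain_approx_le u.disp n))
  have h0 : ∀ n, approx u.disp n refSite = 0 := fun n => by
    have hn : (0 : ℝ) ≤ n + 1 := by positivity
    rw [approx, u.disp_refSite, clamp, min_eq_right hn, max_eq_right (by linarith), mul_zero]
  refine mem_closure_of_tendsto (b := atTop) (f := fun n => H1.ofDisp _ (hs n) (h0 n)) ?_
    (Eventually.of_forall fun n => ?_)
  · rw [strainL2.isometry.isEmbedding.tendsto_nhds_iff]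
    exact L2.tendsto_of_dominated hG (tendsto_strain (tendsto_approx u.disp))
      (Eventually.of_forall fun n => abs_strain_approx_le u.disp n)
  · refine (finite_support_cutoff n).subset fun m hm => ?_
    exact left_ne_zero_of_mul hm

/-! ### Square roots of perturbations of one -/

/-- The cubic Taylor polynomial of `√(1 + w)`. -/
def sqrtTaylor (w : ℂ) : ℂ := 1 + w / 2 - w ^ 2 / 8 + w ^ 3 / 16

theorem norm_sub_one_le_of_sq_eq {q w : ℂ} (hq : q ^ 2 = 1 + w) (h0 : 0 ≤ q.re) :
    ‖q - 1‖ ≤ ‖w‖ := by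
  have h1 : 1 ≤ ‖q + 1‖ := by
    have := Complex.re_le_norm (q + 1)
    rw [Complex.add_re, Complex.one_re] at this
    linarith
  have e : w = (q - 1) * (q + 1) := by linear_combination -hq
  rw [e, norm_mul]
  exact le_mul_of_one_le_right (norm_nonneg _) h1

/-- The square root with nonnegative real part is approximated to fourth order by its Taylor
polynomial; the difference is `(q² - p²) / (q + p)`, and `p` has real part at least `1/2`. -/
theorem norm_sub_sqrtTaylor_le_of_small {q w : ℂ} (hq : q ^ 2 = 1 + w) (h0 : 0 ≤ q.re)
    (hw : ‖w‖ ≤ 1 / 2) : ‖q - sqrtTaylor w‖ ≤ ‖w‖ ^ 4 := by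
  have hn := norm_nonneg w
  have hp : ‖sqrtTaylor w - 1‖ ≤ 1 / 2 := by
    have e : sqrtTaylor w - 1 = w / 2 - w ^ 2 / 8 + w ^ 3 / 16 := by unfold sqrtTaylor; ring
    rw [e]
    refine (norm_add_le _ _).trans ((add_le_add_left (norm_sub_le _ _) _).trans ?_)
    simp only [norm_div, norm_pow, Complex.norm_ofNat]
    have h2 : ‖w‖ ^ 2 ≤ (1 / 2) ^ 2 := by gcongr
    have h3 : ‖w‖ ^ 3 ≤ (1 / 2) ^ 3 := by gcongr
    linarith
  have hre : 1 / 2 ≤ (sqrtTaylor w).re := by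
    have := (Complex.abs_re_le_norm (sqrtTaylor w - 1)).trans hp
    rw [Complex.sub_re, Complex.one_re] at this
    linarith [(abs_le.1 this).1]
  have hsum : 1 / 2 ≤ ‖q + sqrtTaylor w‖ := by
    have := Complex.re_le_norm (q + sqrtTaylor w)
    rw [Complex.add_re] at this
    linarith
  have e : (q - sqrtTaylor w) * (q + sqrtTaylor w)
      = w ^ 4 * (-(5 / 64) + w / 64 - w ^ 2 / 256) := by
    unfold sqrtTaylor
    linear_combination hq
  have hr : ‖-(5 / 64) + w / 64 - w ^ 2 / 256‖ ≤ 1 / 2 := by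
    refine (norm_sub_le _ _).trans ((add_le_add_left (norm_add_le _ _) _).trans ?_)
    simp only [norm_neg, norm_div, norm_pow, Complex.norm_ofNat]
    have h2 : ‖w‖ ^ 2 ≤ (1 / 2) ^ 2 := by gcongr
    linarith
  have h := congrArg norm e
  rw [norm_mul, norm_mul, norm_pow] at h
  have h1 : ‖q - sqrtTaylor w‖ * (1 / 2) ≤ ‖w‖ ^ 4 * (1 / 2) := by
    calc _ ≤ ‖q - sqrtTaylor w‖ * ‖q + sqrtTaylor w‖ := by gcongr
      _ = _ := h
      _ ≤ _ := by gcongr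
  linarith

theorem norm_sub_sqrtTaylor_le {q w : ℂ} (hq : q ^ 2 = 1 + w) (h0 : 0 ≤ q.re) (hw : ‖w‖ ≤ 2) :
    ‖q - sqrtTaylor w‖ ≤ 100 * ‖w‖ ^ 4 := by
  rcases le_total ‖w‖ (1 / 2) with h | h
  · have := norm_sub_sqrtTaylor_le_of_small hq h0 h
    have h4 : 0 ≤ ‖w‖ ^ 4 := by positivity
    linarith
  · have h1 := norm_sub_one_le_of_sq_eq hq h0
    have e : q - sqrtTaylor w = (q - 1) - w / 2 + w ^ 2 / 8 - w ^ 3 / 16 := by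
      unfold sqrtTaylor; ring
    have h2 : ‖w‖ ^ 2 ≤ 2 ^ 2 := by gcongr
    have h3 : ‖w‖ ^ 3 ≤ 2 ^ 3 := by gcongr
    -- Here the difference is at most `6`, and `‖w‖ ^ 4` is at least `1 / 16`.
    have h4 : (1 / 2) ^ 4 ≤ ‖w‖ ^ 4 := by gcongr
    rw [e]
    refine (norm_sub_le _ _).trans ((add_le_add_left ((norm_add_le _ _).trans
      (add_le_add_left (norm_sub_le _ _) _)) _).trans ?_)
    simp only [norm_div, norm_pow, Complex.norm_ofNat]
    linarith

/-! ### The complex square root on the lattice -/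

/-- A lattice point as a complex number. -/
def zpt (m : Site) : ℂ := ⟨(pos m).1, (pos m).2⟩

/-- The complex square root of a lattice point. -/
def root (m : Site) : ℂ := ⟨(sqrtMap (pos m)).1, (sqrtMap (pos m)).2⟩

/-- The predictor at unit loading, `ω₂ = Im √z`. -/
def unitPredictor (m : Site) : ℝ := (root m).im

theorem predictor_eq (ε : ℝ) (m : Site) : predictor ε m = ε * unitPredictor m := rfl

theorem zpt_re (m : Site) : (zpt m).re = m.1 - 1 / 2 := rfl

theorem zpt_im (m : Site) : (zpt m).im = m.2 - 1 / 2 := rfl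

theorem zpt_im_pos {m : Site} (h : 1 ≤ m.2) : 0 < (zpt m).im := by
  have : (1 : ℝ) ≤ m.2 := by exact_mod_cast h
  rw [zpt_im]; linarith

theorem zpt_im_neg {m : Site} (h : m.2 ≤ 0) : (zpt m).im < 0 := by
  have : (m.2 : ℝ) ≤ 0 := by exact_mod_cast h
  rw [zpt_im]; linarith

theorem zpt_im_ne_zero (m : Site) : (zpt m).im ≠ 0 := by
  rcases le_or_gt m.2 0 with h | h
  · exact (zpt_im_neg h).ne
  · exact (zpt_im_pos h).ne'

theorem zpt_ne_zero (m : Site) : zpt m ≠ 0 := fun h => zpt_im_ne_zero m (by rw [h]; rfl)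

theorem root_re (m : Site) : (root m).re = √‖zpt m‖ * Real.cos ((zpt m).arg / 2) := rfl

theorem root_im (m : Site) : (root m).im = √‖zpt m‖ * Real.sin ((zpt m).arg / 2) := rfl

theorem root_sq (m : Site) : root m ^ 2 = zpt m := by
  have hs := Real.sq_sqrt (norm_nonneg (zpt m))
  have h2 : (zpt m).arg = 2 * ((zpt m).arg / 2) := by ring
  apply Complex.ext
  · rw [sq, Complex.mul_re, root_re, root_im, ← Complex.norm_mul_cos_arg (zpt m)]
    conv_rhs => rw [h2, Real.cos_two_mul']
    linear_combination (Real.cos ((zpt m).arg / 2) ^ 2 - Real.sin ((zpt m).arg / 2) ^ 2) * hs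
  · rw [sq, Complex.mul_im, root_re, root_im, ← Complex.norm_mul_sin_arg (zpt m)]
    conv_rhs => rw [h2, Real.sin_two_mul]
    linear_combination (2 * Real.sin ((zpt m).arg / 2) * Real.cos ((zpt m).arg / 2)) * hs

theorem root_ne_zero (m : Site) : root m ≠ 0 := fun h => zpt_ne_zero m (by
  rw [← root_sq, h]; simp)

theorem norm_root_sq (m : Site) : ‖root m‖ ^ 2 = ‖zpt m‖ := by
  rw [← norm_pow, root_sq]

/-- Lattice points avoid the branch cut, so their square roots have positive real part. -/
theorem root_re_pos (m : Site) : 0 < (root m).re := by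
  rw [root_re]
  have h1 : 0 < √‖zpt m‖ := Real.sqrt_pos.2 (norm_pos_iff.2 (zpt_ne_zero m))
  have h2 : (zpt m).arg < Real.pi := Complex.arg_lt_pi_iff.2 (Or.inr (zpt_im_ne_zero m))
  have h3 := Complex.neg_pi_lt_arg (zpt m)
  exact mul_pos h1 (Real.cos_pos_of_mem_Ioo ⟨by linarith, by linarith⟩)

theorem root_im_mul_zpt_im (m : Site) : (zpt m).im = 2 * (root m).re * (root m).im := by
  rw [← root_sq, sq, Complex.mul_im]; ring

theorem root_im_pos {m : Site} (h : 1 ≤ m.2) : 0 < (root m).im := by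
  have h1 := zpt_im_pos h
  rw [root_im_mul_zpt_im] at h1
  exact pos_of_mul_pos_right h1 (by linarith [root_re_pos m])

theorem root_im_neg {m : Site} (h : m.2 ≤ 0) : (root m).im < 0 := by
  have h1 := zpt_im_neg h
  rw [root_im_mul_zpt_im] at h1
  by_contra h2
  have := mul_nonneg (mul_pos two_pos (root_re_pos m)).le (not_lt.1 h2)
  linarith

theorem eq_of_sq_eq_sq_of_re_pos {a b : ℂ} (h : a ^ 2 = b ^ 2) (ha : 0 < a.re) (hb : 0 < b.re) :
    a = b := by
  rcases sq_eq_sq_iff_eq_or_eq_neg.1 h with h | h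
  · exact h
  · rw [h, Complex.neg_re] at ha
    linarith

/-- Reflection of the lattice in the line of the crack. -/
def mirror (m : Site) : Site := (m.1, 1 - m.2)

theorem mirror_mirror (m : Site) : mirror (mirror m) = m := by
  simp [mirror]

theorem zpt_mirror (m : Site) : zpt (mirror m) = (starRingEnd ℂ) (zpt m) := by
  apply Complex.ext
  · rfl
  · rw [Complex.conj_im, zpt_im, zpt_im]
    simp only [mirror]
    push_cast
    ring

theorem root_mirror (m : Site) : root (mirror m) = (starRingEnd ℂ) (root m) := by
  refine eq_of_sq_eq_sq_of_re_pos ?_ (root_re_pos _) (by simpa using root_re_pos m)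
  rw [root_sq, zpt_mirror, ← map_pow, root_sq]

theorem unitPredictor_mirror (m : Site) : unitPredictor (mirror m) = -unitPredictor m := by
  rw [unitPredictor, root_mirror, Complex.conj_im]; rfl

/-- A lattice direction as a complex number. -/
def cdir (ρ : ℤ × ℤ) : ℂ := ⟨ρ.1, ρ.2⟩

theorem zpt_add (m : Site) (ρ : ℤ × ℤ) : zpt (m + ρ) = zpt m + cdir ρ := by
  apply Complex.ext
  · simp only [Complex.add_re, zpt_re, cdir, Prod.fst_add]; push_cast; ring
  · simp only [Complex.add_im, zpt_im, cdir, Prod.snd_add]; push_cast; ring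

theorem norm_cdir {ρ : ℤ × ℤ} (hρ : ρ ∈ dirs) : ‖cdir ρ‖ = 1 := by
  rw [mem_dirs] at hρ
  rcases hρ with rfl | rfl | rfl | rfl <;>
    simp [cdir, Complex.norm_def, Complex.normSq_mk]

theorem one_le_two_mul_norm_zpt (m : Site) : 1 ≤ 2 * ‖zpt m‖ := by
  have h := Complex.abs_im_le_norm (zpt m)
  rcases le_or_gt m.2 0 with hm | hm
  · have : (m.2 : ℝ) ≤ 0 := by exact_mod_cast hm
    have h2 := (abs_le.1 h).1
    rw [zpt_im] at h2
    linarith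
  · have : (1 : ℝ) ≤ m.2 := by exact_mod_cast hm
    have h2 := (abs_le.1 h).2
    rw [zpt_im] at h2
    linarith

theorem re_div_nonneg {a b : ℂ} (h : 0 ≤ a.re * b.re + a.im * b.im) : 0 ≤ (a / b).re := by
  rw [Complex.div_re, ← add_div]
  exact div_nonneg h (Complex.normSq_nonneg b)

/-- Along every direction, the predictor is continued from `m` by a branch of the square root:
`√z q` with `q = √(1 + ρ/z)`. Across the crack the continued branch takes at `z̄` the value `-conj √z`,
whose imaginary part is that of `√z`: the continuation is even about the crack, and therefore deleting the
bond is the same as keeping it with the continued values. -/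
theorem exists_branch_factor (m : Site) (ρ : dirs) :
    ∃ q : ℂ, q ^ 2 = 1 + cdir ρ / zpt m ∧ 0 ≤ q.re ∧
      strain unitPredictor (m, ρ) = (root m * (q - 1)).im := by
  have hz := zpt_ne_zero m
  have hr := root_ne_zero m
  obtain ⟨ρ, hρ⟩ := ρ
  by_cases hb : ρ ∈ dirsAt m
  · refine ⟨root (m + ρ) / root m, ?_, ?_, ?_⟩
    · rw [div_pow, root_sq, root_sq, zpt_add]
      field_simp
    · apply re_div_nonneg
      have h1 := root_re_pos m
      have h2 := root_re_pos (m + ρ)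
      by_cases hs : (1 ≤ m.2 ∧ 1 ≤ (m + ρ).2) ∨ (m.2 ≤ 0 ∧ (m + ρ).2 ≤ 0)
      · rcases hs with ⟨ha, hb⟩ | ⟨ha, hb⟩
        · have := root_im_pos ha
          have := root_im_pos hb
          positivity
        · have := mul_pos_of_neg_of_neg (root_im_neg hb) (root_im_neg ha)
          positivity
      · -- The bond crosses the line of the crack to the right of the tip.
        have hm : m + ρ = mirror m ∧ 1 ≤ m.1 := by
          obtain ⟨a, b⟩ := m
          rw [mem_dirsAt, mem_dirs] at hb
          obtain ⟨h0, h3, h4⟩ := hb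
          rcases h0 with rfl | rfl | rfl | rfl <;>
            simp [mirror] at hs h3 h4 ⊢ <;> omega
        have hx : 0 < (zpt m).re := by
          have : (1 : ℝ) ≤ m.1 := by exact_mod_cast hm.2
          rw [zpt_re]; linarith
        rw [← root_sq, sq, Complex.mul_re] at hx
        rw [hm.1, root_mirror, Complex.conj_re, Complex.conj_im]
        linarith
    · rw [strain_of_mem (b := (m, ⟨ρ, hρ⟩)) _ hb, mul_sub, mul_div_cancel₀ _ hr, mul_one,
        Complex.sub_im]
      rfl
  · have hm : m + ρ = mirror m ∧ m.1 ≤ 0 := by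
      rw [mem_dirsAt] at hb
      have h : (m.1 ≤ 0 ∧ m.2 = 1 ∧ ρ = (0, -1)) ∨ (m.1 ≤ 0 ∧ m.2 = 0 ∧ ρ = (0, 1)) := by tauto
      obtain ⟨a, b⟩ := m
      rcases h with ⟨ha, hb, rfl⟩ | ⟨ha, hb, rfl⟩ <;> simp_all [mirror]
    refine ⟨-(root (mirror m)) / root m, ?_, ?_, ?_⟩
    · rw [div_pow, neg_sq, root_sq, root_sq, ← hm.1, zpt_add]
      field_simp
    · apply re_div_nonneg
      have hx : (zpt m).re < 0 := by
        have : (m.1 : ℝ) ≤ 0 := by exact_mod_cast hm.2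
        rw [zpt_re]; linarith
      rw [← root_sq, sq, Complex.mul_re] at hx
      rw [root_mirror, Complex.neg_re, Complex.neg_im, Complex.conj_re, Complex.conj_im]
      linarith
    · rw [strain_of_notMem (b := (m, ⟨ρ, hρ⟩)) _ hb, mul_sub, mul_div_cancel₀ _ hr, mul_one,
        Complex.sub_im, root_mirror, Complex.neg_im, Complex.conj_im]
      ring

theorem abs_strain_unitPredictor_le (b : Bond) :
    |strain unitPredictor b| ≤ ‖root b.1‖ / ‖zpt b.1‖ := by
  obtain ⟨q, hq, h0, he⟩ := exists_branch_factor b.1 b.2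
  have h1 := norm_sub_one_le_of_sq_eq hq h0
  rw [norm_div, norm_cdir b.2.2] at h1
  calc |strain unitPredictor b| = |(root b.1 * (q - 1)).im| := by rw [← he]
    _ ≤ ‖root b.1 * (q - 1)‖ := Complex.abs_im_le_norm _
    _ ≤ ‖root b.1‖ * (1 / ‖zpt b.1‖) := by rw [norm_mul]; gcongr
    _ = _ := mul_one_div _ _

/-- The residual of the predictor: its Laplacian on the cracked lattice. -/
def residual (m : Site) : ℝ := ∑ ρ : dirs, strain unitPredictor (m, ρ)

/-- The terms up to third order of `√(1 + ρ/z)` cancel in the sum over the four directions. -/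
theorem sum_sqrtTaylor (z : ℂ) : ∑ ρ : dirs, (sqrtTaylor (cdir ρ / z) - 1) = 0 := by
  rw [Finset.sum_coe_sort dirs fun ρ => sqrtTaylor (cdir ρ / z) - 1]
  have e1 : cdir (1, 0) = 1 := by apply Complex.ext <;> simp [cdir]
  have e2 : cdir (0, 1) = Complex.I := by apply Complex.ext <;> simp [cdir]
  have e3 : cdir (-1, 0) = -1 := by apply Complex.ext <;> simp [cdir]
  have e4 : cdir (0, -1) = -Complex.I := by apply Complex.ext <;> simp [cdir]
  have e : ∑ ρ ∈ dirs, (sqrtTaylor (cdir ρ / z) - 1)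
      = (sqrtTaylor (1 / z) - 1) + ((sqrtTaylor (Complex.I / z) - 1)
        + ((sqrtTaylor (-1 / z) - 1) + (sqrtTaylor (-Complex.I / z) - 1))) := by
    rw [dirs, Finset.sum_insert (by decide), Finset.sum_insert (by decide),
      Finset.sum_insert (by decide), Finset.sum_singleton, e1, e2, e3, e4]
  rw [e]
  unfold sqrtTaylor
  linear_combination (-(1 / 4) * (1 / z) ^ 2) * Complex.I_sq

theorem abs_residual_le (m : Site) : |residual m| ≤ 400 * (‖root m‖ / ‖zpt m‖ ^ 4) := by
  have hz : 0 < ‖zpt m‖ := norm_pos_iff.2 (zpt_ne_zero m)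
  choose q hq h0 he using exists_branch_factor m
  have e : residual m = (root m * ∑ ρ : dirs, (q ρ - sqrtTaylor (cdir ρ / zpt m))).im := by
    have e1 : ∑ ρ : dirs, (q ρ - 1) = ∑ ρ : dirs, (q ρ - sqrtTaylor (cdir ρ / zpt m)) := by
      rw [← sub_eq_zero, ← Finset.sum_sub_distrib, ← sum_sqrtTaylor (zpt m)]
      exact Finset.sum_congr rfl fun ρ _ => by ring
    rw [residual, ← e1, Finset.mul_sum, Complex.im_sum]
    exact Finset.sum_congr rfl fun ρ _ => he ρ
  have hb : ∀ ρ : dirs, ‖q ρ - sqrtTaylor (cdir ρ / zpt m)‖ ≤ 100 * (1 / ‖zpt m‖) ^ 4 := fun ρ => by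
    have hn : ‖cdir ρ / zpt m‖ = 1 / ‖zpt m‖ := by rw [norm_div, norm_cdir ρ.2]
    rw [← hn]
    refine norm_sub_sqrtTaylor_le (hq ρ) (h0 ρ) ?_
    rw [hn, div_le_iff₀ hz]
    exact one_le_two_mul_norm_zpt m
  have hcard : Fintype.card dirs = 4 := by rw [Fintype.card_coe]; rfl
  calc |residual m| ≤ ‖root m * ∑ ρ : dirs, (q ρ - sqrtTaylor (cdir ρ / zpt m))‖ := by
        rw [e]; exact Complex.abs_im_le_norm _
    _ ≤ ‖root m‖ * ∑ ρ : dirs, 100 * (1 / ‖zpt m‖) ^ 4 := by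
        rw [norm_mul]
        gcongr
        exact (norm_sum_le _ _).trans (Finset.sum_le_sum fun ρ _ => hb ρ)
    _ = _ := by
        rw [Finset.sum_const, Finset.card_univ, hcard, one_div_pow]
        simp only [nsmul_eq_mul]
        push_cast
        ring

/-! ### Decay of the predictor and of its residual -/

theorem siteNorm_le_two_mul_norm_zpt (m : Site) : ((max 1 (siteNorm m) : ℕ) : ℝ) ≤ 2 * ‖zpt m‖ := by
  have h0 := one_le_two_mul_norm_zpt m
  have key : ∀ a : ℤ, |(a : ℝ) - 1 / 2| ≤ ‖zpt m‖ → (a.natAbs : ℝ) ≤ 2 * ‖zpt m‖ := fun a ha => by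
    rw [Nat.cast_natAbs, Int.cast_abs]
    have h1 := abs_le.1 ha
    rcases le_or_gt a 0 with h | h
    · have : (a : ℝ) ≤ 0 := by exact_mod_cast h
      rw [abs_of_nonpos this]
      linarith
    · have : (1 : ℝ) ≤ a := by exact_mod_cast h
      rw [abs_of_nonneg (by linarith)]
      linarith
  rw [siteNorm, Nat.cast_max, Nat.cast_max, Nat.cast_one]
  exact max_le h0 (max_le (key _ (Complex.abs_re_le_norm (zpt m)))
    (key _ (Complex.abs_im_le_norm (zpt m))))

theorem summable_norm_zpt_rpow {s : ℝ} (hs : 2 < s) : Summable fun m : Site => ‖zpt m‖ ^ (-s) := by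
  have h1 : Summable fun n : ℕ => (n : ℝ) * (((max 1 n : ℕ) : ℝ) / 2) ^ (-s) := by
    refine ((Real.summable_nat_rpow.2 (by linarith : 1 - s < -1)).mul_left ((2 : ℝ) ^ s)).congr
      fun n => ?_
    rcases Nat.eq_zero_or_pos n with rfl | hn
    · rw [Nat.cast_zero, zero_mul, Real.zero_rpow (by linarith), mul_zero]
    · have hn' : (0 : ℝ) < n := by exact_mod_cast hn
      rw [max_eq_right hn, Real.div_rpow hn'.le zero_le_two, Real.rpow_neg zero_le_two,
        sub_eq_add_neg, Real.rpow_add hn', Real.rpow_one, div_inv_eq_mul]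
      ring
  refine (summable_siteNorm (F := fun n => (((max 1 n : ℕ) : ℝ) / 2) ^ (-s))
    (fun n => by positivity) h1).of_nonneg_of_le (fun m => by positivity) fun m => ?_
  have hpos : (0 : ℝ) < ((max 1 (siteNorm m) : ℕ) : ℝ) := by
    exact_mod_cast lt_of_lt_of_le one_pos (le_max_left 1 (siteNorm m))
  refine Real.rpow_le_rpow_of_nonpos (by positivity) ?_ (by linarith)
  linarith [siteNorm_le_two_mul_norm_zpt m]

theorem norm_root_eq_rpow (m : Site) : ‖root m‖ = ‖zpt m‖ ^ (1 / 2 : ℝ) := by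
  rw [← Real.sqrt_eq_rpow, ← norm_root_sq, Real.sqrt_sq (norm_nonneg _)]

theorem norm_zpt_pos (m : Site) : 0 < ‖zpt m‖ := norm_pos_iff.2 (zpt_ne_zero m)

theorem norm_root_div_pow_eq (m : Site) (j : ℕ) :
    ‖root m‖ / ‖zpt m‖ ^ j = ‖zpt m‖ ^ (1 / 2 - j : ℝ) := by
  rw [norm_root_eq_rpow, Real.rpow_sub (norm_zpt_pos m), Real.rpow_natCast]

theorem summable_strain_unitPredictor_pow : Summable fun b => strain unitPredictor b ^ 6 := by
  have h := summable_norm_zpt_rpow (s := 3) (by norm_num)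
  refine (summable_bond_of_summable_site h fun m => by positivity).of_nonneg_of_le
    (fun b => by positivity) fun b => ?_
  have h1 := abs_strain_unitPredictor_le b
  have hz := norm_zpt_pos b.1
  have e : (‖root b.1‖ / ‖zpt b.1‖) ^ 6 = ‖zpt b.1‖ ^ (-3 : ℝ) := by
    have e3 : ‖zpt b.1‖ ^ (-3 : ℝ) = (‖zpt b.1‖ ^ 3)⁻¹ := by
      rw [Real.rpow_neg hz.le]; norm_cast
    have e6 : ‖root b.1‖ ^ 6 = ‖zpt b.1‖ ^ 3 := by rw [← norm_root_sq]; ring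
    rw [e3, div_pow, e6]
    field_simp
  rw [← e, ← Even.pow_abs (by decide : Even 6)]
  gcongr

theorem memℓp_top_strain_unitPredictor : Memℓp (strain unitPredictor) ⊤ := by
  refine memℓp_infty ⟨2, ?_⟩
  rintro _ ⟨b, rfl⟩
  have h1 := one_le_two_mul_norm_zpt b.1
  have hz := norm_zpt_pos b.1
  refine (abs_strain_unitPredictor_le b).trans ((div_le_iff₀ hz).2 ?_)
  refine abs_le_of_sq_le_sq' ?_ (by positivity) |>.2
  rw [norm_root_sq]
  nlinarith

/-- The strains of the predictor at unit loading. -/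
def predictorStrain : LInf Bond := ⟨strain unitPredictor, memℓp_top_strain_unitPredictor⟩

theorem predictorStrain_apply (b : Bond) : predictorStrain b = strain unitPredictor b := rfl

theorem summable_predictorStrain_pow : Summable fun b => predictorStrain b ^ 6 := by
  simpa only [predictorStrain_apply] using summable_strain_unitPredictor_pow

theorem summable_residual : Summable residual := by
  have h := (summable_norm_zpt_rpow (s := 7 / 2) (by norm_num)).mul_left 400
  refine Summable.of_norm_bounded h fun m => (abs_residual_le m).trans (le_of_eq ?_)
  rw [norm_root_div_pow_eq]
  norm_num

/-- The residual decays like `|z|^(-7/2)` and `u` grows at most like `4 |z| ‖u‖`; the product is summable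
over the plane. -/
theorem abs_residual_mul_le (u : H1) (m : Site) :
    |residual m * u.disp m| ≤ 1600 * ‖zpt m‖ ^ (-(5 / 2) : ℝ) * ‖u‖ := by
  have hz := norm_zpt_pos m
  have key : ∀ a : ℤ, |(a : ℝ) - 1 / 2| ≤ ‖zpt m‖ → |(a : ℝ) - 1| ≤ 2 * ‖zpt m‖ := fun a ha => by
    have h1 := abs_le.1 ha
    rcases le_or_gt a 0 with h | h
    · have : (a : ℝ) ≤ 0 := by exact_mod_cast h
      rw [abs_of_nonpos (by linarith)]
      linarith
    · have : (1 : ℝ) ≤ a := by exact_mod_cast h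
      rw [abs_of_nonneg (by linarith)]
      linarith
  have h1 := key _ (Complex.abs_re_le_norm (zpt m))
  have h2 := key _ (Complex.abs_im_le_norm (zpt m))
  have h3 := u.abs_disp_le m
  rw [abs_mul]
  calc |residual m| * |u.disp m|
      ≤ 400 * (‖root m‖ / ‖zpt m‖ ^ 4) * (4 * ‖zpt m‖ * ‖u‖) := by
        refine mul_le_mul (abs_residual_le m) (h3.trans ?_) (abs_nonneg _) (by positivity)
        gcongr
        linarith
    _ = 1600 * (‖root m‖ / ‖zpt m‖ ^ 3) * ‖u‖ := by field_simp; ring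
    _ = _ := by rw [norm_root_div_pow_eq]; norm_num

theorem summable_residual_mul (u : H1) : Summable fun m => residual m * u.disp m :=
  Summable.of_norm_bounded
    (((summable_norm_zpt_rpow (s := 5 / 2) (by norm_num)).mul_left 1600).mul_right ‖u‖)
    (abs_residual_mul_le u)

/-- The linear functional `u ↦ -2 ∑ₘ f(m) u(m)`, `f` being the residual of the predictor: the bounded
extension of `u ↦ ∑_b (Dω₂)_b (Du)_b`, a series that need not converge on the energy space. -/
def residualForce : H1 →L[ℝ] ℝ :=
  LinearMap.mkContinuous
    { toFun := fun u => -2 * ∑' m, residual m * u.disp m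
      map_add' := fun u v => by
        rw [← mul_add, ← (summable_residual_mul u).tsum_add (summable_residual_mul v)]
        simp only [H1.disp_add, mul_add]
      map_smul' := fun c u => by
        simp only [H1.disp_smul, mul_left_comm _ c, tsum_mul_left, smul_eq_mul, RingHom.id_apply] }
    (2 * ∑' m, 1600 * ‖zpt m‖ ^ (-(5 / 2) : ℝ)) (fun u => by
      have h := (summable_norm_zpt_rpow (s := 5 / 2) (by norm_num)).mul_left 1600
      have hb := tsum_of_norm_bounded (f := fun m => residual m * u.disp m) (h.mul_right ‖u‖).hasSum
        (abs_residual_mul_le u)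
      rw [tsum_mul_right] at hb
      change ‖-2 * ∑' m, residual m * u.disp m‖ ≤ _
      rw [norm_mul, norm_neg, Real.norm_ofNat, mul_assoc]
      gcongr)

theorem residualForce_apply (u : H1) :
    residualForce u = -2 * ∑' m, residual m * u.disp m := rfl

/-! ### Symmetry of the residual -/

/-- Reflection of a direction in the line of the crack. -/
def mirrorDir (ρ : dirs) : dirs :=
  ⟨((ρ : ℤ × ℤ).1, -(ρ : ℤ × ℤ).2), by
    obtain ⟨ρ, hρ⟩ := ρ
    rw [mem_dirs] at hρ
    rcases hρ with rfl | rfl | rfl | rfl <;> simp [dirs]⟩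

theorem mirrorDir_involutive : Function.Involutive mirrorDir := fun ρ => by
  apply Subtype.ext
  simp [mirrorDir]

theorem mirror_add (m : Site) (ρ : dirs) : mirror m + mirrorDir ρ = mirror (m + ρ) := by
  simp only [mirror, mirrorDir, Prod.fst_add, Prod.snd_add, Prod.mk_add_mk, Prod.mk.injEq, true_and]
  ring

theorem mirrorDir_mem_dirsAt {m : Site} {ρ : dirs} :
    (mirrorDir ρ : ℤ × ℤ) ∈ dirsAt (mirror m) ↔ (ρ : ℤ × ℤ) ∈ dirsAt m := by
  rw [mem_dirsAt, mem_dirsAt]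
  obtain ⟨⟨x, y⟩, hρ⟩ := ρ
  have h := (mirrorDir ⟨(x, y), hρ⟩).2
  simp only [mirrorDir, mirror, Prod.mk.injEq] at h ⊢
  simp only [h, hρ, true_and]
  omega

theorem strain_unitPredictor_mirror (m : Site) (ρ : dirs) :
    strain unitPredictor (mirror m, mirrorDir ρ) = -strain unitPredictor (m, ρ) := by
  by_cases hb : (ρ : ℤ × ℤ) ∈ dirsAt m
  · rw [strain_of_mem (b := (m, ρ)) _ hb,
      strain_of_mem (b := (mirror m, mirrorDir ρ)) _ (mirrorDir_mem_dirsAt.2 hb)]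
    simp only [mirror_add, unitPredictor_mirror]
    ring
  · rw [strain_of_notMem (b := (m, ρ)) _ hb,
      strain_of_notMem (b := (mirror m, mirrorDir ρ)) _ (mt mirrorDir_mem_dirsAt.1 hb), neg_zero]

theorem residual_mirror (m : Site) : residual (mirror m) = -residual m := by
  rw [residual, residual, ← Finset.sum_neg_distrib]
  exact (Fintype.sum_equiv mirrorDir_involutive.toPerm _ _
    fun ρ => (strain_unitPredictor_mirror m ρ).symm).symm

/-- The predictor exerts no net force, because it is odd under reflection in the crack. -/
theorem tsum_residual : ∑' m, residual m = 0 := by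
  have h := (Function.Involutive.toPerm mirror mirror_mirror).tsum_eq residual
  have e : ∀ m, residual ((Function.Involutive.toPerm mirror mirror_mirror) m) = -residual m :=
    residual_mirror
  simp only [e, tsum_neg] at h
  linarith

/-! ### Summation by parts -/

/-- The bond with the opposite orientation. -/
def reverse (b : Bond) : Bond := (b.1 + b.2, ⟨-b.2, neg_mem_dirs b.2.2⟩)

theorem reverse_involutive : Function.Involutive reverse := fun b => by
  apply Prod.ext
  · simp [reverse]
  · apply Subtype.ext
    simp [reverse]

theorem strain_reverse (u : Site → ℝ) (b : Bond) : strain u (reverse b) = -strain u b := by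
  by_cases hb : (b.2 : ℤ × ℤ) ∈ dirsAt b.1
  · have h : ((reverse b).2 : ℤ × ℤ) ∈ dirsAt (reverse b).1 := neg_mem_dirsAt hb
    rw [strain_of_mem _ h, strain_of_mem _ hb]
    simp [reverse]
  · have h : ((reverse b).2 : ℤ × ℤ) ∉ dirsAt (reverse b).1 := fun h => by
      have h2 := neg_mem_dirsAt h
      simp [reverse] at h2
      exact hb h2
    rw [strain_of_notMem _ h, strain_of_notMem _ hb, neg_zero]

theorem tsum_strain_mul_strain {w : Site → ℝ} (hw : (Function.support w).Finite) :
    ∑' b, strain unitPredictor b * strain w b = -2 * ∑' m, residual m * w m := by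
  have hfin : (Function.support fun b : Bond => strain unitPredictor b * w b.1).Finite := by
    refine (hw.prod (Set.toFinite (Set.univ : Set dirs))).subset fun b hb => ?_
    exact ⟨right_ne_zero_of_mul hb, mem_univ _⟩
  have hs : Summable fun b : Bond => strain unitPredictor b * w b.1 :=
    summable_of_hasFiniteSupport hfin
  have hs' : Summable fun b : Bond => strain unitPredictor (reverse b) * w (reverse b).1 :=
    (reverse_involutive.toPerm reverse).summable_iff.2 hs
  have e1 : ∑' b : Bond, strain unitPredictor (reverse b) * w (reverse b).1
      = ∑' b : Bond, strain unitPredictor b * w b.1 :=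
    (reverse_involutive.toPerm reverse).tsum_eq fun b : Bond => strain unitPredictor b * w b.1
  have e2 : ∑' b : Bond, strain unitPredictor b * w b.1 = ∑' m, residual m * w m := by
    rw [hs.tsum_prod]
    exact tsum_congr fun m => by rw [tsum_fintype, residual, Finset.sum_mul]
  have e3 : ∀ b : Bond, strain unitPredictor b * strain w b
      = -(strain unitPredictor (reverse b) * w (reverse b).1) - strain unitPredictor b * w b.1 := by
    intro b
    rw [strain_reverse]
    by_cases hb : (b.2 : ℤ × ℤ) ∈ dirsAt b.1
    · rw [strain_of_mem w hb]
      change _ = -(-strain unitPredictor b * w (b.1 + b.2)) - _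
      ring
    · rw [strain_of_notMem w hb, strain_of_notMem unitPredictor hb]
      ring
  rw [tsum_congr e3, hs'.neg.tsum_sub hs, tsum_neg, e1, e2]
  ring

/-- A displacement with finitely many nonzero strains is constant outside a finite set: the exterior
of a box remains connected when the bonds across the crack are removed. -/
theorem exists_const_of_finite_support_strain {u : Site → ℝ}
    (hu : (Function.support (strain u)).Finite) : ∃ c, (Function.support fun m => u m - c).Finite := by
  obtain ⟨N, hN⟩ := (hu.image fun b => siteNorm b.1).bddAbove
  have step : ∀ (m : Site) (ρ : ℤ × ℤ), N < siteNorm m → ρ ∈ dirsAt m → u (m + ρ) = u m := by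
    intro m ρ hm hρ
    have hρ' : ρ ∈ dirs := (mem_dirsAt.1 hρ).1
    by_contra hne
    have hb : ((m, ⟨ρ, hρ'⟩) : Bond) ∈ Function.support (strain u) := by
      rw [Function.mem_support, strain_of_mem (b := (m, ⟨ρ, hρ'⟩)) _ hρ]
      exact sub_ne_zero.2 hne
    exact absurd (hN ⟨_, hb, rfl⟩) (not_le.2 hm)
  have up : ∀ a b : ℤ, N < siteNorm (a, b) → (0 < a ∨ b ≠ 0) → u (a, b + 1) = u (a, b) := by
    intro a b hm h
    have := step (a, b) (0, 1) hm (mem_dirsAt.2 ⟨by simp [dirs], by simp, by simp; omega⟩)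
    simpa using this
  have right : ∀ a b : ℤ, N < siteNorm (a, b) → u (a + 1, b) = u (a, b) := by
    intro a b hm
    have := step (a, b) (1, 0) hm (horizontal_mem_dirsAt _)
    simpa using this
  refine ⟨u (N + 1, 1), ?_⟩
  have column : ∀ b : ℤ, u (N + 1, b) = u (N + 1, 1) := fun b =>
    const_of_step (f := fun b => u (N + 1, b))
      (fun b => up _ _ (by simp only [siteNorm]; omega) (by omega)) b
  have row : ∀ a b : ℤ, N < b.natAbs → u (a, b) = u (N + 1, 1) := fun a b hb => by
    have h := const_of_step (f := fun a => u (a, b))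
      (fun a => right _ _ (by simp only [siteNorm]; omega))
    exact (h a).trans ((h (N + 1)).symm.trans (column b))
  have far : ∀ a b : ℤ, N < a.natAbs → u (a, b) = u (N + 1, 1) := fun a b ha => by
    -- Each of the two half columns above and below the crack reaches a row beyond the box.
    rcases le_or_gt b 0 with hb | hb
    · have h := const_of_step (f := fun b => u (a, min 0 b)) (fun b => by
        rcases le_or_gt 0 b with h | h
        · simp only [min_eq_left h, min_eq_left (by omega : 0 ≤ b + 1)]
        · simp only [min_eq_right h.le, min_eq_right (by omega : b + 1 ≤ 0)]
          exact up _ _ (by simp only [siteNorm]; omega) (by omega))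
      have h1 := (h b).trans (h (-(N + 1))).symm
      simp only [min_eq_right hb, min_eq_right (by omega : -((N : ℤ) + 1) ≤ 0)] at h1
      exact h1.trans (row _ _ (by omega))
    · have h := const_of_step (f := fun b => u (a, max 1 b)) (fun b => by
        rcases le_or_gt 1 b with h | h
        · simp only [max_eq_right h, max_eq_right (by omega : 1 ≤ b + 1)]
          exact up _ _ (by simp only [siteNorm]; omega) (by omega)
        · simp only [max_eq_left h.le, max_eq_left (by omega : b + 1 ≤ 1)])
      have h1 := (h b).trans (h (N + 1)).symm
      simp only [max_eq_right (by omega : 1 ≤ b), max_eq_right (by omega : 1 ≤ (N : ℤ) + 1)] at h1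
      exact h1.trans (row _ _ (by omega))
  refine ((Set.finite_Icc (-(N : ℤ)) N).prod (Set.finite_Icc (-(N : ℤ)) N)).subset fun m hm => ?_
  obtain ⟨a, b⟩ := m
  by_contra hout
  refine hm (sub_eq_zero.2 ?_)
  by_cases ha : N < a.natAbs
  · exact far a b ha
  · refine row a b ?_
    by_contra hb
    exact hout ⟨⟨by omega, by omega⟩, ⟨by omega, by omega⟩⟩

theorem strain_sub_const (u : Site → ℝ) (c : ℝ) : strain (fun m => u m - c) = strain u := by
  funext b
  by_cases hb : (b.2 : ℤ × ℤ) ∈ dirsAt b.1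
  · rw [strain_of_mem _ hb, strain_of_mem _ hb]; ring
  · rw [strain_of_notMem _ hb, strain_of_notMem _ hb]

theorem residualForce_eq_tsum {u : H1} (hu : (Function.support (strain u.disp)).Finite) :
    residualForce u = ∑' b, strain unitPredictor b * strain u.disp b := by
  obtain ⟨c, hc⟩ := exists_const_of_finite_support_strain hu
  have h := tsum_strain_mul_strain hc
  rw [strain_sub_const] at h
  have e : ∑' m, residual m * (u.disp m - c) = ∑' m, residual m * u.disp m := by
    simp only [mul_sub]
    rw [(summable_residual_mul u).tsum_sub (summable_residual.mul_right c), tsum_mul_right,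
      tsum_residual, zero_mul, sub_zero]
  rw [h, e, residualForce_apply]

/-! ### The energy difference on the energy space -/

/-- The continuous extension of the energy difference, in closed form. -/
def extendedEnergy (φ : ℝ → ℝ) (ε : ℝ) (u : H1) : ℝ :=
  renormEnergy φ (ε • predictorStrain) (strainL2 u) + ε * residualForce u

/-- The hypotheses on the pair potential. Four derivatives suffice for the cubic bound on `φ'(t) - t`;
further regularity of `φ` only enters through that of the energy. -/
structure IsPairPotential (φ : ℝ → ℝ) : Prop where
  contDiff : ContDiff ℝ 4 φ
  even : ∀ r, φ (-r) = φ r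
  deriv_deriv_zero : deriv (deriv φ) 0 = 1

variable {φ : ℝ → ℝ}

theorem IsPairPotential.contDiff_two (h : IsPairPotential φ) : ContDiff ℝ 2 φ :=
  h.contDiff.of_le (by norm_num)

theorem IsPairPotential.memℓp (h : IsPairPotential φ) (ε : ℝ) :
    Memℓp (fun b => deriv φ ((ε • predictorStrain) b) - (ε • predictorStrain) b) 2 :=
  memℓp_deriv_smul_sub h.contDiff h.even h.deriv_deriv_zero summable_predictorStrain_pow ε

theorem strain_predictor (ε : ℝ) (b : Bond) :
    strain (predictor ε) b = (ε • predictorStrain) b := by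
  change _ = ε * strain unitPredictor b
  by_cases hb : (b.2 : ℤ × ℤ) ∈ dirsAt b.1
  · rw [strain_of_mem _ hb, strain_of_mem _ hb, predictor_eq, predictor_eq, mul_sub]
  · rw [strain_of_notMem _ hb, strain_of_notMem _ hb, mul_zero]

/-- On displacements with finitely many nonzero strains the closed form is the energy difference; the
linear term subtracted in `renormEnergy` is restored by summation by parts. -/
theorem extendedEnergy_eq_energySeries (ε : ℝ) {u : H1}
    (hu : (Function.support (strain u.disp)).Finite) :
    extendedEnergy φ ε u = energySeries φ ε u := by
  set a : LInf Bond := ε • predictorStrain with ha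
  have hlin : Summable fun b => a b * strain u.disp b :=
    summable_of_hasFiniteSupport (hu.subset fun b hb => right_ne_zero_of_mul hb)
  have hdiff : Summable fun b => φ (a b + strain u.disp b) - φ (a b) := by
    refine summable_of_hasFiniteSupport (hu.subset fun b hb => ?_)
    rw [Function.mem_support] at hb ⊢
    intro h0
    rw [h0, add_zero, sub_self] at hb
    exact hb rfl
  have h1 : ε * residualForce u = ∑' b, a b * strain u.disp b := by
    rw [residualForce_eq_tsum hu, ← tsum_mul_left]
    exact tsum_congr fun b => (mul_assoc _ _ _).symm
  have h2 : renormEnergy φ a (strainL2 u)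
      = ∑' b, (φ (a b + strain u.disp b) - φ (a b)) - ∑' b, a b * strain u.disp b :=
    hdiff.tsum_sub hlin
  rw [extendedEnergy, h1, h2, sub_add_cancel, hdiff.tsum_prod, energySeries]
  refine tsum_congr fun m => ?_
  rw [tsum_fintype, pairPotential, pairPotential, ← Finset.sum_sub_distrib]
  refine Finset.sum_congr rfl fun ρ _ => ?_
  rw [ha, ← strain_predictor]
  rfl

theorem finite_support_strain {u : Site → ℝ} (hu : (Function.support (grad u)).Finite) :
    (Function.support (strain u)).Finite := by
  refine (hu.prod (Set.toFinite (Set.univ : Set dirs))).subset fun b hb => ⟨fun h0 => hb ?_, mem_univ _⟩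
  change grad u b.1 b.2 = 0
  rw [h0]; rfl

theorem finite_support_strain_of_finite_support {u : Site → ℝ}
    (hu : (Function.support u).Finite) : (Function.support (strain u)).Finite := by
  have h1 := hu.prod (Set.toFinite (Set.univ : Set dirs))
  refine (h1.union (h1.preimage reverse_involutive.injective.injOn)).subset fun b hb => ?_
  by_contra hout
  rw [mem_union, not_or] at hout
  have z1 : u b.1 = 0 := by
    by_contra hne
    exact hout.1 ⟨hne, mem_univ _⟩
  have z2 : u (b.1 + b.2) = 0 := by
    by_contra hne
    exact hout.2 ⟨hne, mem_univ _⟩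
  refine hb ?_
  by_cases hb' : (b.2 : ℤ × ℤ) ∈ dirsAt b.1
  · rw [strain_of_mem _ hb', z1, z2, sub_zero]
  · exact strain_of_notMem _ hb'

theorem contDiff_extendedEnergy (h : IsPairPotential φ) {n : ℕ} (hn : ContDiff ℝ (n + 2 : ℕ) φ)
    (ε : ℝ) : ContDiff ℝ (n + 2 : ℕ) (extendedEnergy φ ε) :=
  ((contDiff_renormEnergy hn (h.memℓp ε)).comp strainL2.toContinuousLinearMap.contDiff).add
    (contDiff_const.mul residualForce.contDiff)

theorem continuous_extendedEnergy (h : IsPairPotential φ) (ε : ℝ) :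
    Continuous (extendedEnergy φ ε) :=
  (contDiff_extendedEnergy (n := 0) h (by simpa using h.contDiff_two) ε).continuous

theorem tendsto_energySeries (h : IsPairPotential φ) (ε : ℝ) (u : H1) :
    Tendsto (energySeries φ ε) (𝓝[compactlySupported] u) (𝓝 (extendedEnergy φ ε u)) := by
  refine (((continuous_extendedEnergy h ε).tendsto u).mono_left nhdsWithin_le_nhds).congr' ?_
  filter_upwards [self_mem_nhdsWithin] with w hw
  exact extendedEnergy_eq_energySeries ε (finite_support_strain_of_finite_support hw)

theorem energy_eq_extendedEnergy (h : IsPairPotential φ) (ε : ℝ) :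
    energy φ ε = extendedEnergy φ ε :=
  funext fun u => extendFrom_eq (dense_compactlySupported u) (tendsto_energySeries h ε u)

/-! ### Equilibria at small loading -/

theorem fderiv_extendedEnergy_apply (h : IsPairPotential φ) (ε : ℝ) (u v : H1) :
    fderiv ℝ (extendedEnergy φ ε) u v
      = inner ℝ (renormForce φ (ε • predictorStrain) (strainL2 u)) (strainL2 v)
        + ε * residualForce v := by
  have h1 := (hasFDerivAt_renormEnergy h.contDiff_two (h.memℓp ε) (strainL2 u)).comp u
    strainL2.toContinuousLinearMap.hasFDerivAt
  have h2 := h1.add (residualForce.hasFDerivAt (x := u).const_mul ε)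
  have h3 : HasFDerivAt (extendedEnergy φ ε) _ u := h2
  rw [h3.fderiv]
  rfl

theorem fderiv_extendedEnergy_eq (h : IsPairPotential φ) (ε : ℝ) (u : H1) :
    fderiv ℝ (extendedEnergy φ ε) u
      = (innerSL ℝ (renormForce φ (ε • predictorStrain) (strainL2 u))).comp
          strainL2.toContinuousLinearMap + ε • residualForce :=
  ContinuousLinearMap.ext fun v => fderiv_extendedEnergy_apply h ε u v

theorem continuous_fderiv_extendedEnergy (h : IsPairPotential φ) (u : H1) :
    Continuous fun ε => fderiv ℝ (extendedEnergy φ ε) u := by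
  simp only [fderiv_extendedEnergy_eq h]
  have hc := continuous_renormForce_smul (a := predictorStrain) h.contDiff h.even
    h.deriv_deriv_zero summable_predictorStrain_pow (strainL2 u)
  exact (((innerSL ℝ).continuous.comp hc).clm_comp continuous_const).add
    (continuous_id.smul continuous_const)

/-- In the unloaded, undeformed state the equilibrium equation holds. -/
theorem fderiv_extendedEnergy_zero (h : IsPairPotential φ) :
    fderiv ℝ (extendedEnergy φ 0) 0 = 0 := by
  have h0 : renormForce φ ((0 : ℝ) • predictorStrain) (strainL2 0) = 0 := by
    obtain ⟨C, -, hC⟩ := exists_abs_deriv_sub_id_le h.contDiff h.even h.deriv_deriv_zero 0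
    have hz : deriv φ 0 = 0 := by simpa using hC 0 (by simp)
    refine lp.ext (funext fun b => ?_)
    rw [renormForce_apply h.contDiff_two (h.memℓp 0), zero_smul, map_zero]
    simp [hz]
  rw [fderiv_extendedEnergy_eq h, h0, map_zero, zero_smul, add_zero]
  rfl

theorem nearRiesz_extendedEnergy (h : IsPairPotential φ) {δ : ℝ}
    (hδ : ∀ t, |t| ≤ δ → |deriv (deriv φ) t - 1| ≤ 1 / 2) {ε r : ℝ}
    (hε : ‖ε • predictorStrain‖ + r ≤ δ) : NearRiesz (extendedEnergy φ ε) r := by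
  intro u v hu hv
  refine ContinuousLinearMap.opNorm_le_bound _ (by positivity) fun w => ?_
  have hL := norm_sub_sub_renormForce_le h.contDiff_two (h.memℓp ε) hδ
    (x := strainL2 u) (y := strainL2 v)
    (by rw [LinearIsometry.norm_map]; linarith) (by rw [LinearIsometry.norm_map]; linarith)
  rw [← map_sub, LinearIsometry.norm_map] at hL
  have e : (innerSL ℝ (u - v) - (fderiv ℝ (extendedEnergy φ ε) u
      - fderiv ℝ (extendedEnergy φ ε) v)) w
      = inner ℝ (strainL2 (u - v) - (renormForce φ (ε • predictorStrain) (strainL2 u)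
        - renormForce φ (ε • predictorStrain) (strainL2 v))) (strainL2 w) := by
    change inner ℝ (u - v) w - (fderiv ℝ (extendedEnergy φ ε) u w
      - fderiv ℝ (extendedEnergy φ ε) v w) = _
    rw [fderiv_extendedEnergy_apply h, fderiv_extendedEnergy_apply h,
      inner_sub_left (strainL2 (u - v)), inner_sub_left (renormForce _ _ _), LinearIsometry.inner_map_map]
    ring
  rw [e]
  refine (norm_inner_le_norm _ _).trans ?_
  rw [LinearIsometry.norm_map]
  gcongr

theorem exists_small_loading (h : IsPairPotential φ) :
    ∃ ε₀ > 0, ∃ r > 0, ∀ ε ∈ Ioo (-ε₀) ε₀,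
      NearRiesz (extendedEnergy φ ε) r ∧ ‖fderiv ℝ (extendedEnergy φ ε) 0‖ ≤ r / 4 := by
  obtain ⟨δ, hδ, hδ'⟩ := Metric.continuousAt_iff.1
    ((contDiff_one_deriv h.contDiff_two).continuous_deriv le_rfl).continuousAt (1 / 2) (by norm_num)
  have hδ'' : ∀ t, |t| ≤ δ / 2 → |deriv (deriv φ) t - 1| ≤ 1 / 2 := fun t ht => by
    have := @hδ' t (by rw [Real.dist_eq, sub_zero]; linarith)
    rw [h.deriv_deriv_zero, Real.dist_eq] at this
    exact this.le
  have hr : 0 < δ / 4 := by positivity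
  have c1 : Tendsto (fun ε : ℝ => ‖ε • predictorStrain‖) (𝓝 0) (𝓝 0) := by
    have : Continuous fun ε : ℝ => ‖ε • predictorStrain‖ := by fun_prop
    simpa using this.tendsto 0
  have c2 : Tendsto (fun ε => ‖fderiv ℝ (extendedEnergy φ ε) 0‖) (𝓝 0) (𝓝 0) := by
    simpa [fderiv_extendedEnergy_zero h] using
      (continuous_fderiv_extendedEnergy h 0).norm.tendsto 0
  obtain ⟨ε₀, hε₀, hball⟩ := Metric.eventually_nhds_iff_ball.1
    ((c1.eventually_le_const hr).and (c2.eventually_le_const (by positivity : 0 < δ / 4 / 4)))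
  refine ⟨ε₀, hε₀, δ / 4, hr, fun ε hε => ?_⟩
  obtain ⟨h1, h2⟩ := hball ε (by rwa [Real.ball_eq_Ioo, zero_sub, zero_add])
  exact ⟨nearRiesz_extendedEnergy h hδ'' (by linarith), h2⟩

end AntiPlaneCrack

end

open AntiPlaneCrack
theorem theorem2p1 (k : ℕ) (hk : 5 ≤ k) (φ : ℝ → ℝ) (hφ : ContDiff ℝ k φ)
    (hφ0 : φ 0 = 0) (hφeven : ∀ r : ℝ, φ (-r) = φ r) (hφ2 : deriv (deriv φ) 0 = 1) :
    -- the energy is well defined on the whole space, and `k` times continuously differentiable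
    Dense compactlySupported ∧
    (∀ ε : ℝ,
      (∀ u : H1, Tendsto (energySeries φ ε) (𝓝[compactlySupported] u) (𝓝 (energy φ ε u))) ∧
      (∀ u : H1, (Function.support (grad u.disp)).Finite → energy φ ε u = energySeries φ ε u) ∧
      ContDiff ℝ k (energy φ ε)) ∧
    -- small loading: existence, local uniqueness, continuous dependence, strong stability
    (∃ ε₀ : ℝ, 0 < ε₀ ∧ ∃ r : ℝ, 0 < r ∧ ∃ lam : ℝ, 0 < lam ∧ ∃ ubar : ℝ → H1,
      ContinuousOn ubar (Ioo (-ε₀) ε₀) ∧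
      ∀ ε ∈ Ioo (-ε₀) ε₀,
        ubar ε ∈ Metric.ball (0 : H1) r ∧
        (∀ u ∈ Metric.ball (0 : H1) r, fderiv ℝ (energy φ ε) u = 0 ↔ u = ubar ε) ∧
        (∀ u ∈ Metric.ball (0 : H1) r, u ≠ ubar ε → energy φ ε (ubar ε) < energy φ ε u) ∧
        (∀ v : H1, lam * ‖v‖ ^ 2 ≤ fderiv ℝ (fderiv ℝ (energy φ ε)) (ubar ε) v v)) := by
  have h : IsPairPotential φ :=
    ⟨hφ.of_le (by exact_mod_cast (by omega : 4 ≤ k)), hφeven, hφ2⟩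
  simp only [energy_eq_extendedEnergy h]
  refine ⟨dense_compactlySupported, fun ε => ⟨tendsto_energySeries h ε, fun u hu =>
    extendedEnergy_eq_energySeries ε (finite_support_strain hu), ?_⟩, ?_⟩
  · obtain ⟨n, rfl⟩ : ∃ n, k = n + 2 := ⟨k - 2, by omega⟩
    exact contDiff_extendedEnergy h hφ ε
  · obtain ⟨ε₀, hε₀, r, hr, hsmall⟩ := exists_small_loading h
    exact ⟨ε₀, hε₀, r, hr, 1 / 2, by norm_num, exists_branch_of_nearRiesz hr
      (fun ε => contDiff_extendedEnergy (n := 0) h (by simpa using h.contDiff_two) ε)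
      (fun ε hε => (hsmall ε hε).1) (fun ε hε => (hsmall ε hε).2)
      (continuous_fderiv_extendedEnergy h)⟩
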